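/- Let $N$ be a lattice (a free abelian group of finite rank $n$), $M=\mathrm{Hom}(N,\mathbb Z)$ its dual lattice, $N_{\mathbb R}=N\otimes\mathbb R$ and $M_{\mathbb R}=N_{\mathbb R}^*\supset M$. Let $\sigma\subset N_{\mathbb R}$ be a full-dimensional strongly convex rational polyhedral cone with primitive generators $v_1,\dots,v_r\in N$ (a minimal set of generators of $\sigma$ consisting of primitive lattice vectors), and let $\sigma^\vee=\{w\in M_{\mathbb R} : w\cdot v\ge 0\ \text{for all } v\in\sigma\}$. Let $k$ be a perfect field of characteristic $p>0$. For a graded ring $R$ and a graded $R$-module $W$, the free rank of $W$ is the number of copies of $R$ in a decomposition of $W$ as a finite direct sum of indecomposable homogeneous submodules, when such a decomposition exists and the number does not depend on it. Let $F^e_*R$ be the abelian group $R$ with the $R$-module structure $r\cdot s=r^{p^e}s$ (so $F^e_*R\cong R^{1/p^e}$ for reduced $R$), let $a_e$ be the free rank of $F^e_*R$, and let $s(R)=\lim_{e\to\infty} a_e/p^{ed}$ with $d=\dim R$ be the F-signature of $R$. A semigroup ring $k[S]$ is graded by $S$, the piece of degree $u$ being $k\chi^u$; the homogeneous pieces of $F^e_*k[S]$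 are the same subgroups $k\chi^u$ (in degree $u/p^e$). **Theorem.** Let $L\subset M$ be a sublattice of full rank $n$, let $S=\sigma^\vee\cap L$ and $R=k[S]$. For each $i$ let $c_i=\min\{|u\cdot v_i| : u\in L,\ u\cdot v_i\neq 0\}$, and let $$P_\sigma^L=\{w\in M_{\mathbb R} : 0\le w\cdot v_i<c_i\ \text{ for all } i\}.$$ Then $L$ is the group generated by $S$; the free ranks $a_e$ and the limit $s(R)$ exist, and $$s(R)=\mathrm{Vol}_L(P_\sigma^L)<\infty ,$$ where $\mathrm{Vol}_L$ is the volume on $M_{\mathbb R}$ relative to $L$, i.e. Lebesgue measure in the coordinates given by a $\mathbb Z$-basis of $L$. Moreover, for each $e\ge 0$, $P_\sigma^L\cap\frac1{p^e}L$ is finite and $$a_e=\#\Bigl(P_\sigma^L\cap\tfrac1{p^e}L\Bigr),$$ and this number is also the largest rank of a free direct summand of the (ungraded) $R$-module $F^e_*R$. -/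

import Mathlib

open TensorProduct

/-! ### Free rank and F-signature -/

/-- The module `F^e_* R`: the additive group of `R`, with `r • s = r ^ (p ^ e) * s`. -/
def FrobeniusPushforward (R : Type*) (_p _e : ℕ) : Type _ := R

namespace FrobeniusPushforward

instance (R : Type*) [CommRing R] (p e : ℕ) : AddCommGroup (FrobeniusPushforward R p e) :=
  inferInstanceAs (AddCommGroup R)

noncomputable instance (R : Type*) [CommRing R] (p e : ℕ) [ExpChar R p] :
    Module R (FrobeniusPushforward R p e) :=
  Module.compHom R (iterateFrobenius R p e)

/-- The identity map `R → F^e_* R` of additive groups. -/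
def of {R : Type*} [CommRing R] (p e : ℕ) : R ≃+ FrobeniusPushforward R p e :=
  AddEquiv.refl R

theorem smul_of {R : Type*} [CommRing R] (p e : ℕ) [ExpChar R p] (r s : R) :
    r • of p e s = of p e (r ^ p ^ e * s) := rfl

/-- The homogeneous pieces of `F^e_* R` for a graded ring `R`: they are those of `R`. (If
`F^e_* R` is viewed as `R^{1/p^e}`, the piece with index `g` consists of the `p^e`-th roots of the
elements of degree `g`, and so sits in degree `g / p^e`.) -/
def grading {R : Type*} [CommRing R] {γ : Type*} (𝒜 : γ → AddSubgroup R) (p e : ℕ) (g : γ) :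
    AddSubgroup (FrobeniusPushforward R p e) :=
  (𝒜 g).map (of p e).toAddMonoidHom

end FrobeniusPushforward

/-- A module is indecomposable if it is nonzero and is not the direct sum of two nonzero
submodules. -/
def IsIndecomposableModule (R W : Type*) [CommRing R] [AddCommGroup W] [Module R W] : Prop :=
  Nontrivial W ∧ ∀ A B : Submodule R W, IsCompl A B → A = ⊥ ∨ B = ⊥

/-- A submodule of a graded module is homogeneous if it is additively generated by its homogeneous
elements. -/
def IsHomogeneousSubmodule {R W : Type*} [CommRing R] [AddCommGroup W] [Module R W] {γ : Type*}
    (𝓦 : γ → AddSubgroup W) (A : Submodule R W) : Prop :=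
  A.toAddSubgroup = ⨆ g, A.toAddSubgroup ⊓ 𝓦 g

/-- `D` is the set of summands of a decomposition of the graded module `W` as an internal direct
sum of finitely many indecomposable homogeneous submodules. -/
structure IsIndecomposableDecomposition {R W : Type*} [CommRing R] [AddCommGroup W] [Module R W]
    {γ : Type*} (𝓦 : γ → AddSubgroup W) (D : Set (Submodule R W)) : Prop where
  finite : D.Finite
  homogeneous : ∀ A ∈ D, IsHomogeneousSubmodule 𝓦 A
  indecomposable : ∀ A ∈ D, IsIndecomposableModule R A
  independent : sSupIndep D
  sSup_eq_top : sSup D = ⊤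

/-- `a` is the free rank of the graded module `W`: `W` is a direct sum of indecomposable modules,
and each such decomposition of `W` contains exactly `a` copies of `R`. -/
def IsFreeRank {R W : Type*} [CommRing R] [AddCommGroup W] [Module R W]
    {γ : Type*} (𝓦 : γ → AddSubgroup W) (a : ℕ) : Prop :=
  (∃ D : Set (Submodule R W), IsIndecomposableDecomposition 𝓦 D) ∧
    ∀ D : Set (Submodule R W), IsIndecomposableDecomposition 𝓦 D →
      {A : Submodule R W | A ∈ D ∧ Nonempty (A ≃ₗ[R] R)}.ncard = a

/-- The ungraded module `W` has a free direct summand of rank `b`. -/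
def HasFreeSummandOfRank (R W : Type*) [CommRing R] [AddCommGroup W] [Module R W]
    (b : ℕ) : Prop :=
  ∃ A B : Submodule R W, IsCompl A B ∧ Nonempty (A ≃ₗ[R] (Fin b → R))

/-- `s` is the F-signature of the graded ring `R` (over a perfect field of characteristic `p`):
`s = lim a_e / p ^ (e * d)` with `d = dim R` and `a_e` the free rank of `F^e_* R`. -/
def IsFSignature {R : Type*} [CommRing R] {γ : Type*} (𝒜 : γ → AddSubgroup R) (p : ℕ)
    [ExpChar R p] (s : ℝ) : Prop :=
  ∃ (d : ℕ) (a : ℕ → ℕ), ringKrullDim R = d ∧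
    (∀ e, IsFreeRank (R := R) (FrobeniusPushforward.grading 𝒜 p e) (a e)) ∧
    Filter.Tendsto (fun e : ℕ => (a e : ℝ) / (p : ℝ) ^ (e * d)) Filter.atTop (nhds s)

/-! ### Semigroup rings -/

instance {k : Type*} [Field k] (p : ℕ) [CharP k p] {S : Type*} [AddCommMonoid S] :
    CharP (AddMonoidAlgebra k S) p :=
  charP_of_injective_algebraMap
    (FaithfulSMul.algebraMap_injective k (AddMonoidAlgebra k S)) p

/-- The grading of the semigroup ring `k[S]` in which the piece of degree `u` is `k χ^u`. -/
noncomputable def monomialGrading (k : Type*) [Field k] (S : Type*) [AddCommMonoid S] (u : S) :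
    AddSubgroup (AddMonoidAlgebra k S) :=
  (AddMonoidAlgebra.grade k u).toAddSubgroup

/-! ### Lattices and cones -/

section Toric

variable {N : Type*} [AddCommGroup N]

/-- The inclusion of `M = Hom(N, ℤ)` into `M_ℝ`, the real dual of `N_ℝ = ℝ ⊗ N`. -/
noncomputable def characterToReal (u : Module.Dual ℤ N) : Module.Dual ℝ (ℝ ⊗[ℤ] N) :=
  Module.Dual.baseChange ℝ u

theorem characterToReal_tmul (u : Module.Dual ℤ N) (x : ℝ) (v : N) :
    characterToReal u (x ⊗ₜ v) = x * (u v : ℝ) := by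
  simp [characterToReal, Module.Dual.baseChange, mul_comm]

/-- A nonzero lattice vector is primitive if it is not a proper multiple of a lattice vector. -/
def IsPrimitiveVector (v : N) : Prop :=
  v ≠ 0 ∧ ∀ (d : ℕ) (w : N), v = d • w → d = 1

/-- The `v i` are the primitive generators of `σ`: they generate `σ`, none of them can be
omitted, and each of them is a primitive vector of the lattice `N`. -/
structure IsPrimitiveGenerators {r : ℕ} (σ : PointedCone ℝ (ℝ ⊗[ℤ] N)) (v : Fin r → N) :
    Prop where
  generates : PointedCone.hull ℝ (Set.range fun i => (1 : ℝ) ⊗ₜ[ℤ] v i) = σ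
  minimal : ∀ i, (1 : ℝ) ⊗ₜ[ℤ] v i ∉
    PointedCone.hull ℝ ((fun j => (1 : ℝ) ⊗ₜ[ℤ] v j) '' {j | j ≠ i})
  primitive : ∀ i, IsPrimitiveVector (v i)

/-- The cone `σ^∨ ⊆ M_ℝ` dual to `σ ⊆ N_ℝ`. -/
noncomputable def dualCone (σ : PointedCone ℝ (ℝ ⊗[ℤ] N)) :
    PointedCone ℝ (Module.Dual ℝ (ℝ ⊗[ℤ] N)) :=
  PointedCone.dual (Module.Dual.eval ℝ (ℝ ⊗[ℤ] N)) σ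

/-- The semigroup `S = σ^∨ ∩ L`. -/
noncomputable def coneSemigroup (σ : PointedCone ℝ (ℝ ⊗[ℤ] N))
    (L : AddSubgroup (Module.Dual ℤ N)) : AddSubmonoid (Module.Dual ℤ N) where
  carrier := {u | u ∈ L ∧ characterToReal u ∈ dualCone σ}
  zero_mem' := ⟨L.zero_mem, by simp [characterToReal]⟩
  add_mem' := by
    rintro u w ⟨hu, hu'⟩ ⟨hw, hw'⟩
    refine ⟨L.add_mem hu hw, ?_⟩
    have h : characterToReal (u + w) = characterToReal u + characterToReal w := by
      simp [characterToReal]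
    rw [h]
    exact add_mem hu' hw'

/-- `min |u · v|` over the `u ∈ L` with `u · v ≠ 0`. -/
noncomputable def minPairing (L : AddSubgroup (Module.Dual ℤ N)) (v : N) : ℕ :=
  sInf {m : ℕ | m ≠ 0 ∧ ∃ u ∈ L, (u v).natAbs = m}

/-- The polytope `P_σ^L = {w ∈ M_ℝ | 0 ≤ w · v_i < c_i for all i}`. -/
noncomputable def signaturePolytope (L : AddSubgroup (Module.Dual ℤ N)) {r : ℕ}
    (v : Fin r → N) : Set (Module.Dual ℝ (ℝ ⊗[ℤ] N)) :=
  {w | ∀ i, 0 ≤ w (1 ⊗ₜ v i) ∧ w (1 ⊗ₜ v i) < (minPairing L (v i) : ℝ)}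

/-- The lattice `(1/q) L ⊆ M_ℝ`. -/
noncomputable def fractionalLattice (L : AddSubgroup (Module.Dual ℤ N)) (q : ℕ) :
    Set (Module.Dual ℝ (ℝ ⊗[ℤ] N)) :=
  {w | ∃ u ∈ L, w = (q : ℝ)⁻¹ • characterToReal u}

/-- Volume in `M_ℝ` relative to the full-rank lattice `L ⊆ M` with `ℤ`-basis `b`: the Lebesgue
measure in the coordinates on `M_ℝ` given by `b`. -/
noncomputable def latticeVolume {L : AddSubgroup (Module.Dual ℤ N)} {n : ℕ}
    (b : Module.Basis (Fin n) ℤ L) (A : Set (Module.Dual ℝ (ℝ ⊗[ℤ] N))) : ENNReal :=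
  MeasureTheory.volume {x : Fin n → ℝ |
    ∑ i, x i • characterToReal (b i : Module.Dual ℤ N) ∈ A}

end Toric

/-! Write q = p^e and sort the monomials of `F^e_* k[S]` by degree modulo qL. The monomials of one
class span a submodule, and there are finitely many classes, so `F^e_* k[S]` is the direct sum of
these class modules. Over a perfect field coefficients have q-th roots, so a class module is
torsion-free of rank one (`exists_single_mul_eq_mul_pow`) and any two of its nonzero submodules
meet. Hence class modules are indecomposable, and the decomposition into them is the only
homogeneous one, as an equality of sets of submodules (`eq_range_classModule`).

A class module is isomorphic to R exactly when a single monomial χ^w generates it: a functional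
whose value at χ^w has nonzero constant term forces every degree of the class into w + qS
(`mem_freeDegrees_of_coeff_zero_ne_zero`). The free rank is therefore the number of such w. Reducing
modulo the nonconstant monomials, the same fact bounds the ungraded free summands
(`le_ncard_freeDegrees`).

Convex geometry identifies these w by the inequalities w·v_i < q c_i
(`mem_freeDegrees_coneSemigroup_iff`). They suffice because c_i divides every pairing of L with v_i.
They are necessary because L contains elements that vanish on v_i and are positive on the other v_j,
obtained by separation and rounding. Division by q turns the free degrees into the points of (1/q)L
in the polytope. Counting lattice points in a bounded convex set gives the volume as limit, with
exponent n = dim R found from the transcendence degree. -/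

set_option linter.unusedSectionVars false

/-! ### The module `F^e_* k[S]` -/

section SemigroupRing

namespace FrobeniusPushforward

variable {k : Type*} [Field k] {S : Type*} [AddCommMonoid S] [IsCancelAdd S]

/-- Two degrees are related if their difference in the group generated by `S` is divisible
by `q`. -/
def degreeSetoid (S : Type*) [AddCommMonoid S] [IsCancelAdd S] (q : ℕ) : Setoid S where
  r u w := ∃ s t : S, u + q • s = w + q • t
  iseqv :=
    { refl := fun u => ⟨0, 0, rfl⟩
      symm := fun ⟨s, t, h⟩ => ⟨t, s, h.symm⟩
      trans := by
        rintro u w z ⟨s, t, h⟩ ⟨s', t', h'⟩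
        refine ⟨s + s', t + t', ?_⟩
        rw [nsmul_add, nsmul_add, ← add_assoc, h, add_right_comm, h', add_right_comm, add_assoc,
          add_comm (q • t)] }

theorem degreeSetoid_add_nsmul (q : ℕ) (u s : S) : degreeSetoid S q (u + q • s) u :=
  ⟨0, s, by simp⟩

/-- The degrees that generate their class modulo `q` as a module over `q • S`. -/
def freeDegrees (S : Type*) [AddCommMonoid S] [IsCancelAdd S] (q : ℕ) : Set S :=
  {w | ∀ u, degreeSetoid S q u w → ∃ s, u = w + q • s}

/-- Each of two generators of a class is a translate of the other; cancellation gives q•s + q•t = 0,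
and pointedness kills q•s. -/
theorem freeDegrees_injOn (hS : ∀ s t : S, s + t = 0 → s = 0) {q : ℕ} {w z : S}
    (hw : w ∈ freeDegrees S q) (hz : z ∈ freeDegrees S q) (h : degreeSetoid S q w z) : w = z := by
  obtain ⟨s, hs⟩ := hz w h
  obtain ⟨t, ht⟩ := hw z ((degreeSetoid S q).symm' h)
  have h1 : q • s + q • t = 0 := by
    have : w + (q • s + q • t) = w + 0 := by
      conv_rhs => rw [add_zero, hs, ht]
      abel
    exact add_left_cancel this
  rw [hs, hS _ _ h1, add_zero]

variable (k) (p : ℕ) [Fact p.Prime] [CharP k p] (e : ℕ)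

/-- The monomial `a χ^u` as an element of `F^e_* k[S]`. -/
noncomputable def monomial (u : S) (a : k) : FrobeniusPushforward (AddMonoidAlgebra k S) p e :=
  of p e (AddMonoidAlgebra.single u a)

theorem single_smul_of (s : S) (a : k) (x : AddMonoidAlgebra k S) :
    AddMonoidAlgebra.single s a • of p e x =
      of p e (AddMonoidAlgebra.single (p ^ e • s) (a ^ p ^ e) * x) := by
  rw [smul_of, AddMonoidAlgebra.single_pow]

theorem single_smul_monomial (s u : S) (a b : k) :
    AddMonoidAlgebra.single s a • monomial k p e u b =
      monomial k p e (u + p ^ e • s) (a ^ p ^ e * b) := by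
  rw [monomial, single_smul_of, AddMonoidAlgebra.single_mul_single, add_comm u, monomial]

variable {k p e} in
theorem monomial_induction {motive : FrobeniusPushforward (AddMonoidAlgebra k S) p e → Prop}
    (x : FrobeniusPushforward (AddMonoidAlgebra k S) p e) (zero : motive 0)
    (add : ∀ x y, motive x → motive y → motive (x + y))
    (single : ∀ u a, motive (monomial k p e u a)) : motive x := by
  obtain ⟨x, rfl⟩ := (of p e).surjective x
  induction x using AddMonoidAlgebra.induction_linear with
  | zero => simpa using zero
  | add x y hx hy => rw [map_add]; exact add _ _ hx hy
  | single u a => exact single u a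

/-- The submodule of `F^e_* k[S]` spanned by the monomials with degree in a set `T` closed under
addition of multiples of `p ^ e`. -/
noncomputable def monomialSubmodule (T : Set S) (hT : ∀ u ∈ T, ∀ s, u + p ^ e • s ∈ T) :
    Submodule (AddMonoidAlgebra k S) (FrobeniusPushforward (AddMonoidAlgebra k S) p e) where
  carrier := {x | ∀ u, ((of p e).symm x).coeff u ≠ 0 → u ∈ T}
  zero_mem' := by simp
  add_mem' := by
    intro x y hx hy u hu
    rw [map_add, AddMonoidAlgebra.coeff_add, Finsupp.add_apply] at hu
    by_cases h : ((of p e).symm x).coeff u = 0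
    · exact hy u (by simpa [h] using hu)
    · exact hx u h
  smul_mem' := by
    classical
    intro r x hx
    obtain ⟨x, rfl⟩ := (of p e).surjective x
    simp only [Set.mem_ofPred_eq, AddEquiv.symm_apply_apply] at hx
    induction r using AddMonoidAlgebra.induction_linear with
    | zero => simp
    | add r r' h h' =>
      intro u hu
      rw [add_smul, map_add, AddMonoidAlgebra.coeff_add, Finsupp.add_apply] at hu
      by_cases h0 : ((of p e).symm (r • of p e x)).coeff u = 0
      · exact h' u (by simpa [h0] using hu)
      · exact h u h0
    | single s a =>
      intro u hu
      rw [single_smul_of, AddEquiv.symm_apply_apply] at hu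
      have := AddMonoidAlgebra.support_coeff_single_mul_subset x (a ^ p ^ e) (p ^ e • s)
        (Finsupp.mem_support_iff.2 hu)
      obtain ⟨w, hw, rfl⟩ := Finset.mem_image.1 this
      rw [add_comm]
      exact hT w (hx w (Finsupp.mem_support_iff.1 hw)) s

variable {k p e}

theorem mem_monomialSubmodule {T : Set S} {hT : ∀ u ∈ T, ∀ s, u + p ^ e • s ∈ T}
    {x : FrobeniusPushforward (AddMonoidAlgebra k S) p e} :
    x ∈ monomialSubmodule k p e T hT ↔ ∀ u, ((of p e).symm x).coeff u ≠ 0 → u ∈ T := Iff.rfl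

theorem monomial_mem_monomialSubmodule {T : Set S} {hT : ∀ u ∈ T, ∀ s, u + p ^ e • s ∈ T}
    {u : S} (hu : u ∈ T) (a : k) : monomial k p e u a ∈ monomialSubmodule k p e T hT := by
  classical
  intro w hw
  rw [monomial, AddEquiv.symm_apply_apply, AddMonoidAlgebra.coeff_single,
    Finsupp.single_apply] at hw
  rw [← (ite_ne_right_iff.1 hw).1]
  exact hu

theorem mem_of_monomial_mem {T : Set S} {hT : ∀ u ∈ T, ∀ s, u + p ^ e • s ∈ T} {u : S} {a : k}
    (ha : a ≠ 0) (h : monomial k p e u a ∈ monomialSubmodule k p e T hT) : u ∈ T := by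
  refine h u ?_
  rw [monomial, AddEquiv.symm_apply_apply, AddMonoidAlgebra.coeff_single, Finsupp.single_eq_same]
  exact ha

theorem monomial_ne_zero (u : S) {a : k} (ha : a ≠ 0) : monomial k p e u a ≠ 0 := by
  rw [monomial, Ne, map_eq_zero_iff _ (of p e).injective, AddMonoidAlgebra.single_eq_zero]
  exact ha

theorem monomialSubmodule_mono {T T' : Set S} {hT : ∀ u ∈ T, ∀ s, u + p ^ e • s ∈ T}
    {hT' : ∀ u ∈ T', ∀ s, u + p ^ e • s ∈ T'} (h : T ⊆ T') :
    monomialSubmodule k p e T hT ≤ monomialSubmodule k p e T' hT' :=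
  fun _ hx u hu => h (hx u hu)

theorem sum_monomial (x : FrobeniusPushforward (AddMonoidAlgebra k S) p e) :
    ∑ u ∈ ((of p e).symm x).coeff.support, monomial k p e u (((of p e).symm x).coeff u) = x := by
  obtain ⟨x, rfl⟩ := (of p e).surjective x
  simp only [monomial, AddEquiv.symm_apply_apply, ← map_sum]
  exact congrArg _ (AddMonoidAlgebra.sum_coeff_single x)

theorem mem_of_forall_monomial_mem
    {A : Submodule (AddMonoidAlgebra k S) (FrobeniusPushforward (AddMonoidAlgebra k S) p e)}
    {x : FrobeniusPushforward (AddMonoidAlgebra k S) p e}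
    (h : ∀ u, ((of p e).symm x).coeff u ≠ 0 →
      monomial k p e u (((of p e).symm x).coeff u) ∈ A) : x ∈ A := by
  rw [← sum_monomial x]
  exact A.sum_mem fun u hu => h u (Finsupp.mem_support_iff.1 hu)

theorem monomialSubmodule_disjoint {T T' : Set S} {hT : ∀ u ∈ T, ∀ s, u + p ^ e • s ∈ T}
    {hT' : ∀ u ∈ T', ∀ s, u + p ^ e • s ∈ T'} (h : Disjoint T T') :
    Disjoint (monomialSubmodule k p e T hT) (monomialSubmodule k p e T' hT') := by
  rw [Submodule.disjoint_def]
  intro x hx hx'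
  rw [← sum_monomial x]
  refine Finset.sum_eq_zero fun u hu => ?_
  have hu' := Finsupp.mem_support_iff.1 hu
  exact (Set.disjoint_left.1 h (hx u hu') (hx' u hu')).elim

theorem monomialSubmodule_codisjoint {T T' : Set S} {hT : ∀ u ∈ T, ∀ s, u + p ^ e • s ∈ T}
    {hT' : ∀ u ∈ T', ∀ s, u + p ^ e • s ∈ T'} (h : ∀ u, u ∈ T ∨ u ∈ T') :
    Codisjoint (monomialSubmodule k p e T hT) (monomialSubmodule k p e T' hT') := by
  rw [codisjoint_iff_le_sup]
  intro x _
  refine mem_of_forall_monomial_mem fun u _ => ?_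
  rcases h u with hu | hu
  · exact Submodule.mem_sup_left (monomial_mem_monomialSubmodule hu _)
  · exact Submodule.mem_sup_right (monomial_mem_monomialSubmodule hu _)

theorem mem_grading {u : S} {x : FrobeniusPushforward (AddMonoidAlgebra k S) p e} :
    x ∈ grading (monomialGrading k S) p e u ↔ ∃ a, x = monomial k p e u a := by
  constructor
  · rintro ⟨y, hy, rfl⟩
    obtain ⟨a, rfl⟩ : y ∈ LinearMap.range (AddMonoidAlgebra.lsingle (R := k) u) := by
      rw [← AddMonoidAlgebra.grade_eq_lsingle_range]; exact hy
    exact ⟨a, rfl⟩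
  · rintro ⟨a, rfl⟩
    exact ⟨_, AddMonoidAlgebra.single_mem_grade u a, rfl⟩

/-- The homogeneous pieces are the lines k χ^u, so homogeneity means closure under taking monomial
terms. -/
theorem isHomogeneousSubmodule_iff
    {A : Submodule (AddMonoidAlgebra k S) (FrobeniusPushforward (AddMonoidAlgebra k S) p e)} :
    IsHomogeneousSubmodule (grading (monomialGrading k S) p e) A ↔
      ∀ x ∈ A, ∀ u, monomial k p e u (((of p e).symm x).coeff u) ∈ A := by
  classical
  constructor
  · intro hA x hx u
    have hx' : x ∈ A.toAddSubgroup := hx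
    rw [hA] at hx'
    clear hx
    refine AddSubgroup.iSup_induction _ (C := fun x =>
      monomial k p e u (((of p e).symm x).coeff u) ∈ A) hx' ?_ ?_ ?_
    · intro w y hy
      obtain ⟨a, rfl⟩ := mem_grading.1 hy.2
      by_cases h : w = u
      · subst h
        have : ((of p e).symm (monomial k p e w a)).coeff w = a := by
          rw [monomial, AddEquiv.symm_apply_apply, AddMonoidAlgebra.coeff_single,
            Finsupp.single_eq_same]
        rw [this]
        exact hy.1
      · have : ((of p e).symm (monomial k p e w a)).coeff u = 0 := by
          rw [monomial, AddEquiv.symm_apply_apply, AddMonoidAlgebra.coeff_single,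
            Finsupp.single_eq_of_ne' h]
        rw [this, monomial, AddMonoidAlgebra.single_zero, map_zero]
        exact A.zero_mem
    · simp [monomial]
    · intro y z hy hz
      have : monomial k p e u (((of p e).symm (y + z)).coeff u) =
          monomial k p e u (((of p e).symm y).coeff u) +
            monomial k p e u (((of p e).symm z).coeff u) := by
        simp [monomial]
      rw [this]
      exact A.add_mem hy hz
  · intro hA
    refine le_antisymm ?_ (iSup_le fun g => inf_le_left)
    intro x hx
    rw [← sum_monomial x]
    refine AddSubgroup.sum_mem _ fun u _ => AddSubgroup.mem_iSup_of_mem u ⟨hA x hx u, ?_⟩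
    exact mem_grading.2 ⟨_, rfl⟩

/-! ### The classes of degrees modulo `p ^ e` -/

variable (k p e) in
/-- The submodule of `F^e_* k[S]` spanned by the monomials of degree congruent to `c`. -/
noncomputable def classModule (c : S) :
    Submodule (AddMonoidAlgebra k S) (FrobeniusPushforward (AddMonoidAlgebra k S) p e) :=
  monomialSubmodule k p e {u | degreeSetoid S (p ^ e) u c} fun u hu s =>
    (degreeSetoid S (p ^ e)).trans' (degreeSetoid_add_nsmul _ u s) hu

variable (k p e) in
/-- The submodule of `F^e_* k[S]` spanned by the monomials of degree not congruent to `c`. -/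
noncomputable def coclassModule (c : S) :
    Submodule (AddMonoidAlgebra k S) (FrobeniusPushforward (AddMonoidAlgebra k S) p e) :=
  monomialSubmodule k p e {u | ¬ degreeSetoid S (p ^ e) u c} fun u hu s h =>
    hu ((degreeSetoid S (p ^ e)).trans'
      ((degreeSetoid S (p ^ e)).symm' (degreeSetoid_add_nsmul _ u s)) h)

theorem isCompl_classModule (c : S) : IsCompl (classModule k p e c) (coclassModule k p e c) :=
  ⟨monomialSubmodule_disjoint (Set.disjoint_left.2 fun _ h h' => h' h),
    monomialSubmodule_codisjoint fun _ => em _⟩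

theorem monomial_mem_classModule_of_rel {u c : S} (h : degreeSetoid S (p ^ e) u c) (a : k) :
    monomial k p e u a ∈ classModule k p e c :=
  monomial_mem_monomialSubmodule (T := {u | degreeSetoid S (p ^ e) u c}) h a

theorem monomial_mem_coclassModule_of_not_rel {u c : S} (h : ¬ degreeSetoid S (p ^ e) u c)
    (a : k) : monomial k p e u a ∈ coclassModule k p e c :=
  monomial_mem_monomialSubmodule (T := {u | ¬ degreeSetoid S (p ^ e) u c}) h a

theorem monomial_mem_classModule (c : S) (a : k) : monomial k p e c a ∈ classModule k p e c :=
  monomial_mem_classModule_of_rel ((degreeSetoid S (p ^ e)).refl' c) a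

theorem classModule_eq_of_rel {c d : S} (h : degreeSetoid S (p ^ e) c d) :
    classModule k p e c = classModule k p e d :=
  le_antisymm (monomialSubmodule_mono fun _ hu => (degreeSetoid S (p ^ e)).trans' hu h)
    (monomialSubmodule_mono fun _ hu =>
      (degreeSetoid S (p ^ e)).trans' hu ((degreeSetoid S (p ^ e)).symm' h))

theorem rel_of_classModule_eq {c d : S} (h : classModule k p e c = classModule k p e d) :
    degreeSetoid S (p ^ e) c d := by
  have := monomial_mem_classModule (k := k) (p := p) (e := e) c 1
  rw [h] at this
  exact (mem_of_monomial_mem one_ne_zero this :)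

theorem classModule_le_coclassModule {c d : S} (h : ¬ degreeSetoid S (p ^ e) c d) :
    classModule k p e c ≤ coclassModule k p e d :=
  monomialSubmodule_mono fun _ hu hu' =>
    h ((degreeSetoid S (p ^ e)).trans' ((degreeSetoid S (p ^ e)).symm' hu) hu')

/-- Rank one: in module terms χ^s • x = a • χ^c. Each term of x satisfies this because its
coefficient is a q-th power, and additivity of Frobenius lets the terms be summed over a common χ^s.
-/
theorem exists_single_mul_eq_mul_pow [PerfectField k] {c : S} {x : AddMonoidAlgebra k S}
    (hx : of p e x ∈ classModule k p e c) :
    ∃ (s : S) (a : AddMonoidAlgebra k S), AddMonoidAlgebra.single (p ^ e • s) 1 * x =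
      AddMonoidAlgebra.single c 1 * a ^ p ^ e := by
  classical
  have : PerfectRing k p := PerfectField.toPerfectRing p
  rw [← AddMonoidAlgebra.sum_coeff_single x, Finsupp.sum]
  have key : ∀ u ∈ x.coeff.support, ∃ (s : S) (a : AddMonoidAlgebra k S),
      AddMonoidAlgebra.single (p ^ e • s) 1 * AddMonoidAlgebra.single u (x.coeff u) =
        AddMonoidAlgebra.single c 1 * a ^ p ^ e := by
    intro u hu
    obtain ⟨s, t, h⟩ := hx u (Finsupp.mem_support_iff.1 hu)
    obtain ⟨b, hb⟩ := (bijective_iterateFrobenius (R := k) (p := p) (n := e)).2 (x.coeff u)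
    rw [iterateFrobenius_def] at hb
    refine ⟨s, AddMonoidAlgebra.single t b, ?_⟩
    rw [AddMonoidAlgebra.single_pow, AddMonoidAlgebra.single_mul_single,
      AddMonoidAlgebra.single_mul_single, hb, add_comm _ u, h]
  revert key
  induction x.coeff.support using Finset.induction_on with
  | empty => exact fun _ => ⟨0, 0, by simp [zero_pow (pow_ne_zero e (Fact.out : p.Prime).ne_zero)]⟩
  | insert u A hu ih =>
    intro key
    obtain ⟨s, a, h⟩ := key u (Finset.mem_insert_self u A)
    obtain ⟨t, b, h'⟩ := ih fun w hw => key w (Finset.mem_insert_of_mem hw)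
    refine ⟨s + t, AddMonoidAlgebra.single t 1 * a + AddMonoidAlgebra.single s 1 * b, ?_⟩
    have e1 : AddMonoidAlgebra.single (p ^ e • (s + t)) (1 : k) =
        AddMonoidAlgebra.single (p ^ e • s) 1 * AddMonoidAlgebra.single (p ^ e • t) 1 := by
      rw [AddMonoidAlgebra.single_mul_single, nsmul_add, one_mul]
    rw [Finset.sum_insert hu, add_pow_expChar_pow, mul_pow, mul_pow, AddMonoidAlgebra.single_pow,
      AddMonoidAlgebra.single_pow, one_pow, e1]
    linear_combination AddMonoidAlgebra.single (p ^ e • t) (1 : k) * h +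
      AddMonoidAlgebra.single (p ^ e • s) (1 : k) * h'

theorem smul_ne_zero_of_ne_zero [NoZeroDivisors (AddMonoidAlgebra k S)]
    {r : AddMonoidAlgebra k S} {x : FrobeniusPushforward (AddMonoidAlgebra k S) p e}
    (hr : r ≠ 0) (hx : x ≠ 0) : r • x ≠ 0 := by
  obtain ⟨x, rfl⟩ := (of p e).surjective x
  rw [Ne, map_eq_zero_iff _ (of p e).injective] at hx
  rw [smul_of, Ne, map_eq_zero_iff _ (of p e).injective]
  exact mul_ne_zero (pow_ne_zero _ hr) hx

/-- From χ^s • x = a • χ^c and χ^t • y = b • χ^c, cross-multiplication gives (χ^s b) • x = (χ^t a) •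
y, a nonzero common element. -/
theorem not_disjoint_of_le_classModule [PerfectField k] [NoZeroDivisors (AddMonoidAlgebra k S)]
    {c : S}
    {A B : Submodule (AddMonoidAlgebra k S) (FrobeniusPushforward (AddMonoidAlgebra k S) p e)}
    (hA : A ≤ classModule k p e c) (hB : B ≤ classModule k p e c) (hAB : Disjoint A B) :
    A = ⊥ ∨ B = ⊥ := by
  by_contra! h
  obtain ⟨x, hxA, hx⟩ := A.ne_bot_iff.1 h.1
  obtain ⟨y, hyB, hy⟩ := B.ne_bot_iff.1 h.2
  obtain ⟨x, rfl⟩ := (of p e).surjective x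
  obtain ⟨y, rfl⟩ := (of p e).surjective y
  obtain ⟨s, a, ha⟩ := exists_single_mul_eq_mul_pow (hA hxA)
  obtain ⟨t, b, hb⟩ := exists_single_mul_eq_mul_pow (hB hyB)
  have hs : ∀ u : S, AddMonoidAlgebra.single u (1 : k) ≠ 0 := fun u =>
    AddMonoidAlgebra.single_ne_zero.2 one_ne_zero
  have hb0 : b ≠ 0 := by
    rintro rfl
    rw [zero_pow (pow_ne_zero e (Fact.out : p.Prime).ne_zero), mul_zero] at hb
    rw [Ne, map_eq_zero_iff _ (of p e).injective] at hy
    exact mul_ne_zero (hs _) hy hb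
  have h1 : (AddMonoidAlgebra.single s 1 * b) • of p e x =
      (AddMonoidAlgebra.single t 1 * a) • of p e y := by
    rw [smul_of, smul_of, mul_pow, mul_pow, AddMonoidAlgebra.single_pow,
      AddMonoidAlgebra.single_pow, one_pow]
    congr 1
    linear_combination b ^ p ^ e * ha - a ^ p ^ e * hb
  refine smul_ne_zero_of_ne_zero (mul_ne_zero (hs s) hb0) hx
    (Submodule.disjoint_def.1 hAB _ (A.smul_mem _ hxA) ?_)
  rw [h1]
  exact B.smul_mem _ hyB

/-! ### Existence and uniqueness of the homogeneous decomposition -/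

theorem isHomogeneousSubmodule_classModule (c : S) :
    IsHomogeneousSubmodule (grading (monomialGrading k S) p e) (classModule k p e c) := by
  rw [isHomogeneousSubmodule_iff]
  intro x hx u
  by_cases h : ((of p e).symm x).coeff u = 0
  · simp [h, monomial]
  · exact monomial_mem_monomialSubmodule (hx u h) _

theorem isIndecomposableModule_classModule [PerfectField k]
    [NoZeroDivisors (AddMonoidAlgebra k S)] (c : S) :
    IsIndecomposableModule (AddMonoidAlgebra k S) (classModule k p e c) := by
  refine ⟨⟨⟨⟨_, monomial_mem_classModule c 1⟩, 0, fun h =>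
    monomial_ne_zero c one_ne_zero (congrArg Subtype.val h)⟩⟩, fun A B hAB => ?_⟩
  have hinj := (classModule k p e c).injective_subtype
  have := not_disjoint_of_le_classModule ((classModule k p e c).map_subtype_le A)
    ((classModule k p e c).map_subtype_le B) (Submodule.disjoint_map hinj hAB.disjoint)
  have hmap := Submodule.map_injective_of_injective hinj
  exact this.imp (fun h => hmap (h.trans (Submodule.map_bot _).symm))
    fun h => hmap (h.trans (Submodule.map_bot _).symm)

theorem isIndecomposableDecomposition_range_classModule [PerfectField k]
    [NoZeroDivisors (AddMonoidAlgebra k S)] [Finite (Quotient (degreeSetoid S (p ^ e)))] :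
    IsIndecomposableDecomposition (grading (monomialGrading k S) p e)
      (Set.range (classModule (S := S) k p e)) where
  finite := by
    have : Set.range (classModule (S := S) k p e) =
        Set.range (Quotient.lift (s := degreeSetoid S (p ^ e)) (classModule (S := S) k p e)
          fun _ _ h => classModule_eq_of_rel h) := by
      ext A
      exact ⟨fun ⟨c, hc⟩ => ⟨⟦c⟧, hc⟩, fun ⟨c, hc⟩ => by
        induction c using Quotient.inductionOn with
        | h c => exact ⟨c, hc⟩⟩
    rw [this]
    exact Set.finite_range _
  homogeneous := by
    rintro _ ⟨c, rfl⟩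
    exact isHomogeneousSubmodule_classModule c
  indecomposable := by
    rintro _ ⟨c, rfl⟩
    exact isIndecomposableModule_classModule c
  independent := by
    rintro _ ⟨c, rfl⟩
    refine (isCompl_classModule c).disjoint.mono_right (sSup_le ?_)
    rintro _ ⟨⟨d, rfl⟩, hd⟩
    exact classModule_le_coclassModule fun h => hd (classModule_eq_of_rel h)
  sSup_eq_top := by
    refine eq_top_iff.2 fun x _ => mem_of_forall_monomial_mem fun u _ => ?_
    exact (le_sSup (Set.mem_range_self u) : classModule k p e u ≤ _) (monomial_mem_classModule u _)

/-- The monomial terms of elements of A stay in A, so A splits along the class of c and its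
complement; indecomposability makes one part trivial. -/
theorem le_classModule_or_le_coclassModule
    {A : Submodule (AddMonoidAlgebra k S) (FrobeniusPushforward (AddMonoidAlgebra k S) p e)}
    (hA : IsHomogeneousSubmodule (grading (monomialGrading k S) p e) A)
    (hA' : IsIndecomposableModule (AddMonoidAlgebra k S) A) (c : S) :
    A ≤ classModule k p e c ∨ A ≤ coclassModule k p e c := by
  rw [isHomogeneousSubmodule_iff] at hA
  have hcompl : IsCompl ((classModule k p e c).comap A.subtype)
      ((coclassModule k p e c).comap A.subtype) := by
    constructor
    · rw [Submodule.disjoint_def]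
      intro x hx hx'
      exact Subtype.ext (Submodule.disjoint_def.1 (isCompl_classModule c).disjoint _ hx hx')
    · rw [codisjoint_iff_le_sup]
      intro x _
      have hx : x = ∑ u ∈ ((of p e).symm x.1).coeff.support,
          (⟨_, hA x x.2 u⟩ : A) := by
        apply Subtype.ext
        rw [AddSubmonoidClass.coe_finsetSum]
        exact (sum_monomial _).symm
      rw [hx]
      refine Submodule.sum_mem _ fun u _ => ?_
      by_cases hu : degreeSetoid S (p ^ e) u c
      · exact Submodule.mem_sup_left
          (Submodule.mem_comap.2 (monomial_mem_classModule_of_rel hu _))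
      · exact Submodule.mem_sup_right
          (Submodule.mem_comap.2 (monomial_mem_coclassModule_of_not_rel hu _))
  have htop := hcompl.sup_eq_top
  rcases hA'.2 _ _ hcompl with h | h
  · right
    rw [h, bot_sup_eq] at htop
    exact Submodule.comap_subtype_eq_top.1 htop
  · left
    rw [h, sup_bot_eq] at htop
    exact Submodule.comap_subtype_eq_top.1 htop

theorem exists_le_classModule
    {A : Submodule (AddMonoidAlgebra k S) (FrobeniusPushforward (AddMonoidAlgebra k S) p e)}
    (hA : IsHomogeneousSubmodule (grading (monomialGrading k S) p e) A)
    (hA' : IsIndecomposableModule (AddMonoidAlgebra k S) A) :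
    A ≠ ⊥ ∧ ∃ c, A ≤ classModule k p e c := by
  have hne : A ≠ ⊥ := (Submodule.nontrivial_iff_ne_bot).1 hA'.1
  refine ⟨hne, ?_⟩
  by_contra! h
  refine hne (eq_bot_iff.2 fun x hx => ?_)
  rw [Submodule.mem_bot, ← sum_monomial x]
  refine Finset.sum_eq_zero fun u hu => ?_
  exact ((((le_classModule_or_le_coclassModule hA hA' u).resolve_left (h u)) hx) u
    (Finsupp.mem_support_iff.1 hu) ((degreeSetoid S (p ^ e)).refl' u)).elim

/-- A summand A lies in some class module. Another summand in the same class would meet A, so all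
others lie in the complement, and A must fill its class. No class is missed, since its monomials
would then be unreachable. -/
theorem eq_range_classModule [PerfectField k] [NoZeroDivisors (AddMonoidAlgebra k S)]
    {D : Set (Submodule (AddMonoidAlgebra k S) (FrobeniusPushforward (AddMonoidAlgebra k S) p e))}
    (hD : IsIndecomposableDecomposition (grading (monomialGrading k S) p e) D) :
    D = Set.range (classModule (S := S) k p e) := by
  have key : ∀ A ∈ D, ∃ c, A = classModule k p e c := by
    intro A hA
    obtain ⟨hne, c, hc⟩ := exists_le_classModule (hD.homogeneous A hA) (hD.indecomposable A hA)
    refine ⟨c, le_antisymm hc fun x hx => ?_⟩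
    have hle : sSup (D \ {A}) ≤ coclassModule k p e c := by
      refine sSup_le fun B hB => ?_
      refine (le_classModule_or_le_coclassModule (hD.homogeneous B hB.1)
        (hD.indecomposable B hB.1) c).resolve_left fun hBc => ?_
      have hdisj : Disjoint A B := (hD.independent hA).mono_right (le_sSup hB)
      rcases not_disjoint_of_le_classModule hc hBc hdisj with h | h
      · exact hne h
      · exact (exists_le_classModule (hD.homogeneous B hB.1) (hD.indecomposable B hB.1)).1 h
    have htop : x ∈ A ⊔ sSup (D \ {A}) := by
      rw [← sSup_insert, Set.insert_sdiff_singleton, Set.insert_eq_of_mem hA, hD.sSup_eq_top]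
      trivial
    obtain ⟨y, hy, z, hz, rfl⟩ := Submodule.mem_sup.1 htop
    have hz' : z ∈ classModule k p e c := (Submodule.add_mem_iff_right _ (hc hy)).1 hx
    rw [Submodule.disjoint_def.1 (isCompl_classModule c).disjoint z hz' (hle hz), add_zero]
    exact hy
  apply Set.Subset.antisymm
  · intro A hA
    obtain ⟨c, rfl⟩ := key A hA
    exact ⟨c, rfl⟩
  · rintro _ ⟨c, rfl⟩
    by_contra hc
    have hle : sSup D ≤ coclassModule k p e c := by
      refine sSup_le fun B hB => ?_
      obtain ⟨d, rfl⟩ := key B hB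
      refine classModule_le_coclassModule fun h => hc ?_
      rwa [← classModule_eq_of_rel h]
    rw [hD.sSup_eq_top] at hle
    exact mem_of_monomial_mem (k := k) (p := p) (e := e) one_ne_zero
      (hle (Submodule.mem_top (x := monomial k p e c 1))) ((degreeSetoid S (p ^ e)).refl' c)

/-! ### Free rank -/

variable {k : Type*} [Field k] {S : Type*} [AddCommMonoid S] [IsCancelAdd S]
variable {p : ℕ} [Fact p.Prime] [CharP k p] {e : ℕ}

/-- Compare coefficients at t: the right side has the constant term of g there, while the left side
is supported in s + S. -/
theorem coeff_single_mul_of_mul_eq {s t : S} {f g : AddMonoidAlgebra k S}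
    (h : AddMonoidAlgebra.single s 1 * f = AddMonoidAlgebra.single t 1 * g)
    (hg : g.coeff 0 ≠ 0) : ∃ z, t = s + z := by
  by_contra! hz
  have h1 := AddMonoidAlgebra.coeff_single_mul_of_forall_add_ne (1 : k) f
    (fun d hd => hz d hd.symm)
  have h2 : (AddMonoidAlgebra.single t (1 : k) * g).coeff t = g.coeff 0 := by
    simpa using AddMonoidAlgebra.coeff_single_mul_eq_mul_coeff (x := g) (r := (1 : k)) (m := t)
      (m₁ := t) 0 (fun m _ => by simp)
  rw [h] at h1
  exact hg (h2.symm.trans h1)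

/-- If u + q•s = w + q•t, then χ^s ψ(χ^u) = χ^t ψ(χ^w). The nonzero constant term of ψ(χ^w) forces t
= s + z, and cancelling leaves u = w + q•z. -/
theorem mem_freeDegrees_of_coeff_zero_ne_zero {c w : S} (hw : degreeSetoid S (p ^ e) w c)
    (ψ : classModule k p e c →ₗ[AddMonoidAlgebra k S] AddMonoidAlgebra k S)
    (h : (ψ ⟨monomial k p e w 1, monomial_mem_classModule_of_rel hw 1⟩).coeff 0 ≠ 0) :
    w ∈ freeDegrees S (p ^ e) := by
  intro u hu
  obtain ⟨s, t, hst⟩ := hu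
  have huc := (degreeSetoid S (p ^ e)).trans' ⟨s, t, hst⟩ hw
  have h1 : AddMonoidAlgebra.single s (1 : k) •
        (⟨monomial k p e u 1, monomial_mem_classModule_of_rel huc 1⟩ : classModule k p e c) =
      AddMonoidAlgebra.single t (1 : k) •
        (⟨monomial k p e w 1, monomial_mem_classModule_of_rel hw 1⟩ : classModule k p e c) := by
    apply Subtype.ext
    simp only [Submodule.coe_smul, single_smul_monomial, hst]
  have h2 := congrArg ψ h1
  rw [map_smul, map_smul, smul_eq_mul, smul_eq_mul] at h2
  obtain ⟨z, rfl⟩ := coeff_single_mul_of_mul_eq h2 h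
  refine ⟨z, ?_⟩
  rw [nsmul_add, add_left_comm, add_comm] at hst
  exact add_left_cancel hst

/-- Every element of a perfect field is a `p ^ e`-th power. -/
theorem exists_pow_eq [PerfectField k] (a : k) : ∃ b : k, b ^ p ^ e = a := by
  have : PerfectRing k p := PerfectField.toPerfectRing p
  exact (bijective_iterateFrobenius (R := k) (p := p) (n := e)).2 a

/-- Some monomial term of x must contribute to the constant term; its coefficient is a q-th power,
hence comes out as a scalar, which leaves the case of χ^u. -/
theorem exists_freeDegree_of_coeff_zero_ne_zero [PerfectField k] {c : S}
    (ψ : classModule k p e c →ₗ[AddMonoidAlgebra k S] AddMonoidAlgebra k S)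
    {x : classModule k p e c} (hx : (ψ x).coeff 0 ≠ 0) :
    ∃ w ∈ freeDegrees S (p ^ e), degreeSetoid S (p ^ e) w c := by
  by_contra! h
  apply hx
  have hx' : x = ∑ u ∈ ((of p e).symm x.1).coeff.support.attach,
      ⟨monomial k p e u.1 (((of p e).symm x.1).coeff u.1),
        monomial_mem_classModule_of_rel (x.2 u (Finsupp.mem_support_iff.1 u.2)) _⟩ := by
    apply Subtype.ext
    rw [AddSubmonoidClass.coe_finsetSum]
    exact ((Finset.sum_attach _ fun u => monomial k p e u (((of p e).symm x.1).coeff u)).trans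
      (sum_monomial _)).symm
  rw [hx', map_sum, AddMonoidAlgebra.coeff_sum, Finsupp.finsetSum_apply]
  refine Finset.sum_eq_zero fun u _ => ?_
  have huc : degreeSetoid S (p ^ e) u.1 c := x.2 u (Finsupp.mem_support_iff.1 u.2)
  obtain ⟨b, hb⟩ := exists_pow_eq (p := p) (e := e) (((of p e).symm x.1).coeff u.1)
  have h1 : (⟨monomial k p e u.1 (((of p e).symm x.1).coeff u.1),
        monomial_mem_classModule_of_rel huc _⟩ : classModule k p e c) =
      AddMonoidAlgebra.single (0 : S) b •
        ⟨monomial k p e u.1 1, monomial_mem_classModule_of_rel huc 1⟩ := by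
    apply Subtype.ext
    simp [single_smul_monomial, hb]
  rw [h1, map_smul, smul_eq_mul, AddMonoidAlgebra.coeff_single_zero_mul]
  by_contra hne
  exact h u (mem_freeDegrees_of_coeff_zero_ne_zero huc ψ (right_ne_zero_of_mul hne)) huc

theorem monomial_mem_span_of_eq_add [PerfectField k] {w s : S} (a : k) :
    monomial k p e (w + p ^ e • s) a ∈
      Submodule.span (AddMonoidAlgebra k S) {monomial k p e w 1} := by
  obtain ⟨b, rfl⟩ := exists_pow_eq (p := p) (e := e) a
  rw [← mul_one (b ^ p ^ e), ← single_smul_monomial]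
  exact Submodule.smul_mem _ _ (Submodule.mem_span_singleton_self _)

theorem classModule_eq_span [PerfectField k] {w : S} (hw : w ∈ freeDegrees S (p ^ e)) :
    classModule k p e w = Submodule.span (AddMonoidAlgebra k S) {monomial k p e w 1} := by
  refine le_antisymm (fun x hx => mem_of_forall_monomial_mem fun u hu => ?_) ?_
  · obtain ⟨s, rfl⟩ := hw u (hx u hu)
    exact monomial_mem_span_of_eq_add _
  · rw [Submodule.span_singleton_le_iff_mem]
    exact monomial_mem_classModule w 1

/-- An isomorphism onto R attains the value 1, whose constant term is nonzero. Conversely a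
generator χ^w has zero annihilator because there is no torsion. -/
theorem nonempty_classModule_equiv_iff [PerfectField k] [NoZeroDivisors (AddMonoidAlgebra k S)]
    {c : S} :
    Nonempty (classModule k p e c ≃ₗ[AddMonoidAlgebra k S] AddMonoidAlgebra k S) ↔
      ∃ w ∈ freeDegrees S (p ^ e), degreeSetoid S (p ^ e) w c := by
  constructor
  · rintro ⟨ψ⟩
    refine exists_freeDegree_of_coeff_zero_ne_zero ψ.toLinearMap (x := ψ.symm 1) ?_
    simp [AddMonoidAlgebra.one_def]
  · rintro ⟨w, hw, hwc⟩
    rw [← classModule_eq_of_rel hwc, classModule_eq_span hw]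
    have hinj : Function.Injective (LinearMap.toSpanSingleton (AddMonoidAlgebra k S) _
        (monomial k p e w 1)) := by
      rw [injective_iff_map_eq_zero]
      intro r hr
      by_contra hr0
      exact smul_ne_zero_of_ne_zero hr0 (monomial_ne_zero w one_ne_zero) hr
    exact ⟨((LinearEquiv.ofInjective _ hinj).trans
      (LinearEquiv.ofEq _ _ (LinearMap.range_toSpanSingleton _))).symm⟩

theorem isFreeRank_freeDegrees [PerfectField k] [NoZeroDivisors (AddMonoidAlgebra k S)]
    (hS : ∀ s t : S, s + t = 0 → s = 0) [Finite (Quotient (degreeSetoid S (p ^ e)))] :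
    IsFreeRank (R := AddMonoidAlgebra k S) (grading (monomialGrading k S) p e)
      (freeDegrees S (p ^ e)).ncard := by
  refine ⟨⟨_, isIndecomposableDecomposition_range_classModule⟩, fun D hD => ?_⟩
  rw [eq_range_classModule hD]
  have : {A | A ∈ Set.range (classModule (S := S) k p e) ∧
      Nonempty (A ≃ₗ[AddMonoidAlgebra k S] AddMonoidAlgebra k S)} =
      classModule k p e '' freeDegrees S (p ^ e) := by
    ext A
    constructor
    · rintro ⟨⟨c, rfl⟩, hc⟩
      obtain ⟨w, hw, hwc⟩ := nonempty_classModule_equiv_iff.1 hc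
      exact ⟨w, hw, classModule_eq_of_rel hwc⟩
    · rintro ⟨w, hw, rfl⟩
      exact ⟨⟨w, rfl⟩, nonempty_classModule_equiv_iff.2 ⟨w, hw, (degreeSetoid S (p ^ e)).refl' w⟩⟩
  rw [this]
  exact Set.InjOn.ncard_image fun w hw z hz h =>
    freeDegrees_injOn hS hw hz (rel_of_classModule_eq h)

/-! ### Ungraded free summands -/

theorem finite_freeDegrees (hS : ∀ s t : S, s + t = 0 → s = 0) (q : ℕ)
    [Finite (Quotient (degreeSetoid S q))] : (freeDegrees S q).Finite := by
  refine Set.Finite.of_finite_image (f := fun w => (⟦w⟧ : Quotient (degreeSetoid S q)))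
    (Set.toFinite _) fun w hw z hz h => freeDegrees_injOn hS hw hz (Quotient.exact h)

theorem linearIndependent_freeDegrees [NoZeroDivisors (AddMonoidAlgebra k S)]
    (hS : ∀ s t : S, s + t = 0 → s = 0) :
    LinearIndependent (AddMonoidAlgebra k S)
      fun w : freeDegrees S (p ^ e) => monomial k p e (w : S) 1 := by
  rw [linearIndependent_iff']
  intro A g hg w hw
  by_contra hgw
  refine smul_ne_zero_of_ne_zero hgw
    (monomial_ne_zero (k := k) (p := p) (e := e) (w : S) one_ne_zero)
    (Submodule.disjoint_def.1 (isCompl_classModule (w : S)).disjoint _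
      (Submodule.smul_mem _ _ (monomial_mem_classModule _ _)) ?_)
  classical
  rw [← Finset.add_sum_erase A _ hw, add_eq_zero_iff_eq_neg] at hg
  rw [hg]
  refine Submodule.neg_mem _ (Submodule.sum_mem _ fun z hz => Submodule.smul_mem _ _
    (monomial_mem_coclassModule_of_not_rel (fun h => (Finset.mem_erase.1 hz).1 ?_) _))
  exact Subtype.ext (freeDegrees_injOn hS z.2 w.2 h)

/-- The classes that contain a free degree together span a free module on their generators, and the
remaining monomials span a complement. -/
theorem hasFreeSummandOfRank_freeDegrees [PerfectField k] [NoZeroDivisors (AddMonoidAlgebra k S)]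
    (hS : ∀ s t : S, s + t = 0 → s = 0) [Finite (Quotient (degreeSetoid S (p ^ e)))] :
    HasFreeSummandOfRank (AddMonoidAlgebra k S)
      (FrobeniusPushforward (AddMonoidAlgebra k S) p e) (freeDegrees S (p ^ e)).ncard := by
  have hfin := finite_freeDegrees hS (p ^ e)
  let T : Set S := {u | ∃ w ∈ freeDegrees S (p ^ e), degreeSetoid S (p ^ e) u w}
  have hT : ∀ u ∈ T, ∀ s, u + p ^ e • s ∈ T := fun u ⟨w, hw, h⟩ s =>
    ⟨w, hw, (degreeSetoid S (p ^ e)).trans' (degreeSetoid_add_nsmul _ u s) h⟩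
  have hT' : ∀ u ∈ Tᶜ, ∀ s, u + p ^ e • s ∈ Tᶜ := fun u hu s ⟨w, hw, h⟩ =>
    hu ⟨w, hw, (degreeSetoid S (p ^ e)).trans' ((degreeSetoid S (p ^ e)).symm'
      (degreeSetoid_add_nsmul _ u s)) h⟩
  have hspan : monomialSubmodule k p e T hT = Submodule.span (AddMonoidAlgebra k S)
      (Set.range fun w : freeDegrees S (p ^ e) => monomial k p e (w : S) 1) := by
    refine le_antisymm (fun x hx => mem_of_forall_monomial_mem fun u hu => ?_) ?_
    · obtain ⟨w, hw, h⟩ := hx u hu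
      obtain ⟨s, rfl⟩ := hw u h
      exact Submodule.span_mono (Set.singleton_subset_iff.2
        (Set.mem_range_self (⟨w, hw⟩ : freeDegrees S _)))
        (monomial_mem_span_of_eq_add _)
    · rw [Submodule.span_le]
      rintro _ ⟨w, rfl⟩
      exact monomial_mem_monomialSubmodule
        (show (w : S) ∈ T from ⟨w, w.2, (degreeSetoid S (p ^ e)).refl' _⟩) _
  refine ⟨monomialSubmodule k p e T hT, monomialSubmodule k p e Tᶜ hT',
    ⟨monomialSubmodule_disjoint disjoint_compl_right, monomialSubmodule_codisjoint fun _ => em _⟩,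
    ?_⟩
  rw [hspan]
  have : Finite (freeDegrees S (p ^ e)) := hfin
  have b := Module.Basis.span (linearIndependent_freeDegrees (k := k) (p := p) (e := e) hS)
  exact ⟨(b.reindex (Finite.equivFin _)).equivFun⟩

/-- Project to R^b and take constant terms. Monomials in classes without a free degree map to 0, and
every other monomial maps to a multiple of the image of its generator. So at most as many vectors as
there are free degrees span k^b. -/
theorem le_ncard_freeDegrees [PerfectField k]
    (hS : ∀ s t : S, s + t = 0 → s = 0) [Finite (Quotient (degreeSetoid S (p ^ e)))] {b : ℕ}
    (h : HasFreeSummandOfRank (AddMonoidAlgebra k S)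
      (FrobeniusPushforward (AddMonoidAlgebra k S) p e) b) :
    b ≤ (freeDegrees S (p ^ e)).ncard := by
  classical
  have hfin := finite_freeDegrees hS (p ^ e)
  obtain ⟨A, B, hAB, ⟨φ⟩⟩ := h
  let π : FrobeniusPushforward (AddMonoidAlgebra k S) p e →ₗ[AddMonoidAlgebra k S]
      (Fin b → AddMonoidAlgebra k S) := φ.toLinearMap ∘ₗ A.projectionOnto B hAB
  have hπ : Function.Surjective π :=
    φ.surjective.comp (Submodule.projectionOnto_surjective hAB)
  let f : FrobeniusPushforward (AddMonoidAlgebra k S) p e → Fin b → k :=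
    fun x i => (π x i).coeff 0
  have hf_smul : ∀ (s : S) (a : k) x, ∃ d : k, f (AddMonoidAlgebra.single s a • x) = d • f x := by
    intro s a x
    by_cases hs : s = 0
    · subst hs
      refine ⟨a, funext fun i => ?_⟩
      simp [f, AddMonoidAlgebra.coeff_single_zero_mul]
    -- By pointedness a multiple of χ^s with s ≠ 0 has no constant term.
    · refine ⟨0, funext fun i => ?_⟩
      simp only [f, map_smul, Pi.smul_apply, smul_eq_mul, zero_mul]
      exact AddMonoidAlgebra.coeff_single_mul_of_forall_add_ne _ _ fun d hd => hs (hS _ _ hd)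
  have hspan : Submodule.span k ((fun w => f (monomial k p e w 1)) '' freeDegrees S (p ^ e)) =
      ⊤ := by
    refine eq_top_iff.2 fun y _ => ?_
    obtain ⟨x, hx⟩ := hπ fun i => AddMonoidAlgebra.single 0 (y i)
    have hy : y = f x := by
      funext i
      simp [f, hx]
    rw [hy]
    clear hx hy
    induction x using monomial_induction with
    | zero =>
      convert! Submodule.zero_mem _
      funext i
      simp [f]
    | add x y hx hy =>
      have : f (x + y) = f x + f y := by
        funext i
        simp [f]
      rw [this]
      exact Submodule.add_mem _ hx hy
    | single u a =>
      obtain ⟨c, rfl⟩ := exists_pow_eq (p := p) (e := e) a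
      by_cases hu : ∃ w ∈ freeDegrees S (p ^ e), degreeSetoid S (p ^ e) u w
      · obtain ⟨w, hw, huw⟩ := hu
        obtain ⟨s, rfl⟩ := hw u huw
        rw [← mul_one (c ^ p ^ e), ← single_smul_monomial]
        obtain ⟨d, hd⟩ := hf_smul s c (monomial k p e w 1)
        rw [hd]
        exact Submodule.smul_mem _ _ (Submodule.subset_span ⟨w, hw, rfl⟩)
      · convert! Submodule.zero_mem _
        funext i
        by_contra hne
        obtain ⟨w, hw, hwu⟩ := exists_freeDegree_of_coeff_zero_ne_zero
          ((LinearMap.proj i ∘ₗ π) ∘ₗ (classModule k p e u).subtype)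
          (x := ⟨_, monomial_mem_classModule u (c ^ p ^ e)⟩) hne
        exact hu ⟨w, hw, (degreeSetoid S (p ^ e)).symm' hwu⟩
  have himg := hfin.image fun w => f (monomial k p e w 1)
  calc b = Module.finrank k (Fin b → k) := by simp
    _ = Module.finrank k (Submodule.span k
          ((fun w => f (monomial k p e w 1)) '' freeDegrees S (p ^ e))) := by
        rw [hspan, finrank_top]
    _ ≤ ((fun w => f (monomial k p e w 1)) '' freeDegrees S (p ^ e)).ncard := by
        have := himg.fintype
        rw [Set.ncard_eq_toFinset_card']
        exact finrank_span_le_card _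
    _ ≤ (freeDegrees S (p ^ e)).ncard := Set.ncard_image_le hfin

theorem isGreatest_freeDegrees [PerfectField k] [NoZeroDivisors (AddMonoidAlgebra k S)]
    (hS : ∀ s t : S, s + t = 0 → s = 0) [Finite (Quotient (degreeSetoid S (p ^ e)))] :
    IsGreatest {b | HasFreeSummandOfRank (AddMonoidAlgebra k S)
      (FrobeniusPushforward (AddMonoidAlgebra k S) p e) b} (freeDegrees S (p ^ e)).ncard :=
  ⟨hasFreeSummandOfRank_freeDegrees hS, fun _ h => le_ncard_freeDegrees hS h⟩

end FrobeniusPushforward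

end SemigroupRing

/-! ### The dimension of a semigroup ring -/

/-- Chains of primes lift by lying-over and going-up, and contract strictly by incomparability. -/
theorem ringKrullDim_eq_of_isIntegral (A B : Type*) [CommRing A] [CommRing B] [IsDomain B]
    [Algebra A B]
    [FaithfulSMul A B] [Algebra.IsIntegral A B] : ringKrullDim A = ringKrullDim B := by
  apply le_antisymm
  · refine iSup_le fun l => ?_
    obtain ⟨Q, hQ, hQl⟩ := Ideal.exists_ideal_over_prime_of_isIntegral_of_isDomain (S := B)
      l.head.asIdeal (by
        rw [(RingHom.injective_iff_ker_eq_bot _).1 (FaithfulSMul.algebraMap_injective A B)]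
        exact bot_le)
    have : Q.LiesOver l.head.asIdeal := ⟨hQl.symm⟩
    obtain ⟨l', hl, -⟩ := Ideal.exists_ltSeries_of_hasGoingUp l Q
    rw [← hl]
    exact le_iSup (fun l : LTSeries (PrimeSpectrum B) => (l.length : WithBot ℕ∞)) l'
  · exact Order.krullDim_le_of_strictMono (PrimeSpectrum.comap (algebraMap A B))
      fun I J h => Ideal.IsIntegral.comap_lt_comap (R := A) h

/-- k[G] is algebraic over k[S]: a χ^g is a root of χ^s X − a χ^t when g + s = t. Equality with a
natural number is compared because the two degrees may live in different universes. -/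
theorem trdeg_addMonoidAlgebra_eq_natCast_iff {k S G : Type*} [Field k] [AddCommMonoid S]
    [AddCommMonoid G] [NoZeroDivisors (AddMonoidAlgebra k G)]
    (f : S →+ G) (hf : Function.Injective f) (hgen : ∀ g, ∃ s t, g + f s = f t) (n : ℕ) :
    Algebra.trdeg k (AddMonoidAlgebra k S) = n ↔ Algebra.trdeg k (AddMonoidAlgebra k G) = n := by
  let φ : AddMonoidAlgebra k S →ₐ[k] AddMonoidAlgebra k G :=
    AddMonoidAlgebra.mapDomainAlgHom k k f
  have hφ : Function.Injective φ := AddMonoidAlgebra.mapDomain_injective hf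
  let : Algebra (AddMonoidAlgebra k S) (AddMonoidAlgebra k G) := φ.toRingHom.toAlgebra
  have : IsScalarTower k (AddMonoidAlgebra k S) (AddMonoidAlgebra k G) :=
    IsScalarTower.of_algHom φ
  have : FaithfulSMul (AddMonoidAlgebra k S) (AddMonoidAlgebra k G) :=
    (faithfulSMul_iff_algebraMap_injective _ _).2 hφ
  have : NoZeroDivisors (AddMonoidAlgebra k S) :=
    hφ.noZeroDivisors φ (map_zero _) (map_mul _)
  have : IsDomain (AddMonoidAlgebra k S) := NoZeroDivisors.to_isDomain _
  have halg : Algebra.IsAlgebraic (AddMonoidAlgebra k S) (AddMonoidAlgebra k G) := by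
    refine ⟨fun x => ?_⟩
    induction x using AddMonoidAlgebra.induction_linear with
    | zero => exact isAlgebraic_zero
    | add x y hx hy => exact hx.add hy
    | single g a =>
      obtain ⟨s, t, h⟩ := hgen g
      refine ⟨Polynomial.C (AddMonoidAlgebra.single s 1) * Polynomial.X -
        Polynomial.C (AddMonoidAlgebra.single t a), fun h0 => ?_, ?_⟩
      · have := congrArg (fun q => Polynomial.coeff q 1) h0
        simp at this
      · have h1 : ∀ (s : S) (a : k), algebraMap (AddMonoidAlgebra k S) (AddMonoidAlgebra k G)
            (AddMonoidAlgebra.single s a) = AddMonoidAlgebra.single (f s) a := fun s a =>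
          AddMonoidAlgebra.mapDomain_single
        simp [h1, AddMonoidAlgebra.single_mul_single, ← h, add_comm]
  have h := lift_trdeg_add_eq k (AddMonoidAlgebra k S) (A := AddMonoidAlgebra k G)
  rw [trdeg_eq_zero (R := AddMonoidAlgebra k S), Cardinal.lift_zero, add_zero] at h
  rw [← Cardinal.lift_eq_nat_iff, h, Cardinal.lift_eq_nat_iff]

/-- Noether normalization: A is integral over a polynomial ring, which has the same transcendence
degree and the same dimension. -/
theorem ringKrullDim_eq_of_trdeg {k A : Type*} [Field k] [CommRing A] [IsDomain A] [Algebra k A]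
    [Algebra.FiniteType k A] {n : ℕ} (h : Algebra.trdeg k A = n) : ringKrullDim A = n := by
  obtain ⟨s, g, hg, hg'⟩ := exists_integral_inj_algHom_of_fg k A
  let : Algebra (MvPolynomial (Fin s) k) A := g.toRingHom.toAlgebra
  have : IsScalarTower k (MvPolynomial (Fin s) k) A := IsScalarTower.of_algHom g
  have : FaithfulSMul (MvPolynomial (Fin s) k) A :=
    (faithfulSMul_iff_algebraMap_injective _ _).2 hg
  have : Algebra.IsIntegral (MvPolynomial (Fin s) k) A := ⟨hg'⟩
  have h1 := lift_trdeg_add_eq k (MvPolynomial (Fin s) k) (A := A)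
  rw [trdeg_eq_zero (R := MvPolynomial (Fin s) k), Cardinal.lift_zero, add_zero,
    MvPolynomial.trdeg_of_isDomain, h] at h1
  have hs : s = n := by simpa using h1
  rw [← ringKrullDim_eq_of_isIntegral (MvPolynomial (Fin s) k) A,
    MvPolynomial.ringKrullDim_of_isNoetherianRing, ringKrullDim_eq_zero_of_field, hs]
  simp

/-- Both S and ℕ^n, embedded through the basis, generate G, so k[S] is compared through k[G] with a
polynomial ring in n variables. -/
theorem trdeg_addMonoidAlgebra_eq {k S G : Type*} [Field k] [AddCommMonoid S] [AddCommGroup G]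
    [NoZeroDivisors (AddMonoidAlgebra k G)] {n : ℕ} (b : Module.Basis (Fin n) ℤ G)
    (f : S →+ G) (hf : Function.Injective f) (hgen : ∀ g, ∃ s t, g + f s = f t) :
    Algebra.trdeg k (AddMonoidAlgebra k S) = n := by
  let f' : (Fin n →₀ ℕ) →+ G :=
    { toFun := fun x => ∑ i, x i • b i
      map_zero' := by simp
      map_add' := fun x y => by simp [add_smul, Finset.sum_add_distrib] }
  have hrepr : ∀ x i, b.repr (f' x) i = (x i : ℤ) := by
    intro x i
    have : f' x = ∑ i, (x i : ℤ) • b i := by simp [f']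
    rw [this, b.repr_sum_self]
  have hf' : Function.Injective f' := by
    intro x y h
    ext i
    have := hrepr x i
    rw [h, hrepr y i] at this
    exact_mod_cast this.symm
  have hgen' : ∀ g, ∃ s t, g + f' s = f' t := by
    intro g
    refine ⟨Finsupp.equivFunOnFinite.symm fun i => (-(b.repr g i)).toNat,
      Finsupp.equivFunOnFinite.symm fun i => (b.repr g i).toNat, ?_⟩
    apply b.repr.injective
    ext i
    rw [map_add, Finsupp.add_apply, hrepr, hrepr]
    simp only [Finsupp.equivFunOnFinite_symm_apply_apply]
    omega
  rw [trdeg_addMonoidAlgebra_eq_natCast_iff f hf hgen,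
    ← trdeg_addMonoidAlgebra_eq_natCast_iff f' hf' hgen']
  exact (MvPolynomial.trdeg_of_isDomain (ι := Fin n) (S := k)).trans (by simp)

theorem ringKrullDim_addMonoidAlgebra {k S G : Type*} [Field k] [AddCommMonoid S] [AddCommGroup G]
    [AddMonoid.FG S] [NoZeroDivisors (AddMonoidAlgebra k S)]
    [NoZeroDivisors (AddMonoidAlgebra k G)] {n : ℕ} (b : Module.Basis (Fin n) ℤ G)
    (f : S →+ G) (hf : Function.Injective f) (hgen : ∀ g, ∃ s t, g + f s = f t) :
    ringKrullDim (AddMonoidAlgebra k S) = n :=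
  have : IsDomain (AddMonoidAlgebra k S) := NoZeroDivisors.to_isDomain _
  ringKrullDim_eq_of_trdeg (trdeg_addMonoidAlgebra_eq (k := k) b f hf hgen)

/-! ### Separation -/

/-- The hypothesis says that the compact convex hull of the x i misses the closed subspace ℝy, so
Hahn–Banach separates the two strictly. -/
theorem exists_linearMap_pos_of_forall_sum_eq_smul {V ι : Type*} [AddCommGroup V] [Module ℝ V]
    [FiniteDimensional ℝ V] [Fintype ι] (x : ι → V) (y : V)
    (h : ∀ (l : ι → ℝ) (t : ℝ), (∀ i, 0 ≤ l i) → ∑ i, l i • x i = t • y → ∀ i, l i = 0) :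
    ∃ f : V →ₗ[ℝ] ℝ, f y = 0 ∧ ∀ i, 0 < f (x i) := by
  classical
  let φ := (Module.finBasis ℝ V).equivFun
  let g : (ι → ℝ) →ₗ[ℝ] (Fin (Module.finrank ℝ V) → ℝ) :=
    φ.toLinearMap ∘ₗ Fintype.linearCombination ℝ x
  have hg : ∀ l, g l = φ (∑ i, l i • x i) := fun l => rfl
  obtain ⟨f, u, w, hu, huw, hw⟩ := geometric_hahn_banach_compact_closed
    (s := g '' stdSimplex ℝ ι) (t := (Submodule.span ℝ {φ y} : Set _))
    ((convex_stdSimplex ℝ ι).linear_image g)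
    ((isCompact_stdSimplex ℝ ι).image g.continuous_of_finiteDimensional)
    (Submodule.convex _) (Submodule.closed_of_finiteDimensional _) (by
      rw [Set.disjoint_left]
      rintro _ ⟨l, hl, rfl⟩ hl'
      obtain ⟨t, ht⟩ := Submodule.mem_span_singleton.1 hl'
      rw [hg, ← map_smul] at ht
      have h0 := h l t hl.1 (φ.injective ht).symm
      have := hl.2
      simp [h0] at this)
  have hw0 : w < 0 := by simpa using hw 0 (Submodule.zero_mem _)
  -- A functional bounded below on a subspace vanishes there; otherwise some multiple of y takes the
  -- value w − 1.
  have hfy : f (φ y) = 0 := by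
    by_contra hne
    have := hw (((w - 1) / f (φ y)) • φ y)
      (Submodule.smul_mem _ _ (Submodule.mem_span_singleton_self _))
    rw [map_smul, smul_eq_mul, div_mul_cancel₀ _ hne] at this
    linarith
  refine ⟨-(f.toLinearMap ∘ₗ φ.toLinearMap), by simp [hfy], fun i => ?_⟩
  have := hu (g (Pi.single i 1)) ⟨_, single_mem_stdSimplex ℝ i, rfl⟩
  rw [hg, Finset.sum_eq_single i (fun j _ hj => by simp [hj]) (by simp)] at this
  simp only [Pi.single_eq_same, one_smul] at this
  simp only [LinearMap.neg_apply, LinearMap.comp_apply, LinearEquiv.coe_coe,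
    ContinuousLinearMap.coe_coe]
  linarith

section Toric

/-! ### Pairings with a full-rank lattice of characters -/

variable {N : Type*} [AddCommGroup N]

theorem characterToReal_apply (u : Module.Dual ℤ N) (y : N) :
    characterToReal u (1 ⊗ₜ y) = (u y : ℝ) := by
  rw [characterToReal_tmul, one_mul]

theorem characterToReal_zsmul (m : ℤ) (u : Module.Dual ℤ N) :
    characterToReal (m • u) = (m : ℝ) • characterToReal u := by
  apply LinearMap.ext
  intro y
  rw [LinearMap.smul_apply, characterToReal, map_zsmul, LinearMap.smul_apply, characterToReal,
    zsmul_eq_mul, smul_eq_mul]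

theorem characterToReal_sum {ι : Type*} (A : Finset ι) (u : ι → Module.Dual ℤ N) :
    characterToReal (∑ i ∈ A, u i) = ∑ i ∈ A, characterToReal (u i) := by
  simp [characterToReal]

theorem dual_ext_of_tmul {f g : Module.Dual ℝ (ℝ ⊗[ℤ] N)}
    (h : ∀ y : N, f (1 ⊗ₜ y) = g (1 ⊗ₜ y)) : f = g := by
  ext y
  simpa using h y

theorem characterToReal_injective :
    Function.Injective (characterToReal : Module.Dual ℤ N → Module.Dual ℝ (ℝ ⊗[ℤ] N)) := by
  intro u w h
  ext y
  have := LinearMap.congr_fun h (1 ⊗ₜ y)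
  rw [characterToReal_apply, characterToReal_apply] at this
  exact_mod_cast this

variable (L : AddSubgroup (Module.Dual ℤ N))

theorem exists_pairing_dvd (y : N) : ∃ l ∈ L, ∀ u ∈ L, l y ∣ u y := by
  let f : L →+ ℤ := (LinearMap.applyₗ (R := ℤ) y).toAddMonoidHom.comp L.subtype
  obtain ⟨a, ha⟩ := Int.subgroup_cyclic f.range
  have hmem : a ∈ f.range := by
    rw [ha]
    exact AddSubgroup.mem_closure_singleton_self a
  obtain ⟨l, hl⟩ := hmem
  refine ⟨l, l.2, fun u hu => ?_⟩
  have h1 : (l : Module.Dual ℤ N) y = a := hl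
  have hu' : u y ∈ f.range := ⟨⟨u, hu⟩, rfl⟩
  rw [ha, AddSubgroup.mem_closure_singleton] at hu'
  obtain ⟨m, hm⟩ := hu'
  rw [h1, ← hm]
  exact ⟨m, by simp [mul_comm]⟩

theorem exists_index_nsmul_mem [L.FiniteIndex] :
    ∃ d : ℕ, d ≠ 0 ∧ ∀ u : Module.Dual ℤ N, d • u ∈ L :=
  ⟨L.index, AddSubgroup.FiniteIndex.index_ne_zero, fun u => L.nsmul_index_mem u⟩

theorem exists_dual_apply_ne_zero [Module.Free ℤ N] {y : N} (hy : y ≠ 0) :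
    ∃ u : Module.Dual ℤ N, u y ≠ 0 := by
  by_contra! h
  exact hy ((Module.forall_dual_apply_eq_zero_iff ℤ y).1 h)

/-- The values of L at y form a cyclic subgroup of ℤ, and the least nonzero absolute value is its
generator up to sign. -/
theorem minPairing_spec [Module.Free ℤ N] [L.FiniteIndex] {y : N} (hy : y ≠ 0) :
    0 < minPairing L y ∧ (∀ u ∈ L, (minPairing L y : ℤ) ∣ u y) ∧
      ∃ l ∈ L, l y = minPairing L y := by
  obtain ⟨l, hl, hdvd⟩ := exists_pairing_dvd L y
  obtain ⟨d, hd, hdL⟩ := exists_index_nsmul_mem L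
  obtain ⟨u, hu⟩ := exists_dual_apply_ne_zero hy
  -- A multiple of a character nonzero at y lies in L; so the infimum runs over a nonempty set and
  -- is not the default 0.
  have hl0 : l y ≠ 0 := by
    intro h
    have := hdvd _ (hdL u)
    rw [h, zero_dvd_iff] at this
    simp [hd, hu] at this
  have hmin : minPairing L y = (l y).natAbs := by
    apply le_antisymm
    · exact Nat.sInf_le ⟨Int.natAbs_ne_zero.2 hl0, l, hl, rfl⟩
    · refine le_csInf ⟨_, Int.natAbs_ne_zero.2 hl0, l, hl, rfl⟩ ?_
      rintro m ⟨hm, w, hw, rfl⟩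
      exact Nat.le_of_dvd (Nat.pos_of_ne_zero hm) (Int.natAbs_dvd_natAbs.2 (hdvd w hw))
  rw [hmin]
  refine ⟨Nat.pos_of_ne_zero (Int.natAbs_ne_zero.2 hl0), fun u hu => Int.natAbs_dvd.2 (hdvd u hu),
    ?_⟩
  rcases Int.natAbs_eq (l y) with h | h
  · exact ⟨l, hl, h⟩
  · exact ⟨-l, L.neg_mem hl, by rw [LinearMap.neg_apply, h]; simp⟩

theorem finite_addSubgroup_dual [Module.Free ℤ N] [Module.Finite ℤ N] : Module.Finite ℤ L :=
  Module.Finite.of_injective L.subtype.toIntLinearMap L.subtype_injective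

theorem finrank_addSubgroup_dual [Module.Free ℤ N] [Module.Finite ℤ N] [L.FiniteIndex] :
    Module.finrank ℤ L = Module.finrank ℤ N := by
  have hM : Module.finrank ℤ (Module.Dual ℤ N) = Module.finrank ℤ N := by
    simp [Module.Dual, Module.finrank_linearMap]
  obtain ⟨d, hd, hdL⟩ := exists_index_nsmul_mem L
  rw [← hM]
  apply le_antisymm
  · exact Submodule.finrank_le L.toIntSubmodule
  · have := finite_addSubgroup_dual L
    let f : Module.Dual ℤ N →ₗ[ℤ] L := AddMonoidHom.toIntLinearMap
      ((d • AddMonoidHom.id (Module.Dual ℤ N)).codRestrict L hdL)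
    have hf : Function.Injective f := by
      intro u w h
      have : d • u = d • w := congrArg Subtype.val h
      rw [← natCast_zsmul, ← natCast_zsmul] at this
      exact smul_right_injective _ (by exact_mod_cast hd) this
    exact LinearMap.finrank_le_finrank_of_injective hf

variable {L} in
-- A multiple d M lies in L with d ≠ 0, so L spans over ℝ, and n is already the dimension.
theorem exists_basis_characterToReal [Module.Free ℤ N] [Module.Finite ℤ N] [L.FiniteIndex] {n : ℕ}
    (b : Module.Basis (Fin n) ℤ L) :
    ∃ B : Module.Basis (Fin n) ℝ (Module.Dual ℝ (ℝ ⊗[ℤ] N)),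
      ∀ i, B i = characterToReal (b i : Module.Dual ℤ N) := by
  have hn : n = Module.finrank ℝ (Module.Dual ℝ (ℝ ⊗[ℤ] N)) := by
    rw [Subspace.dual_finrank_eq, Module.finrank_baseChange, ← finrank_addSubgroup_dual L,
      Module.finrank_eq_card_basis b, Fintype.card_fin]
  have hL : ∀ u ∈ L, characterToReal u ∈
      Submodule.span ℝ (Set.range fun i => characterToReal (b i : Module.Dual ℤ N)) := by
    intro u hu
    have : u = ∑ i, b.repr ⟨u, hu⟩ i • (b i : Module.Dual ℤ N) := by
      have := congrArg L.subtype (b.sum_repr ⟨u, hu⟩)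
      rw [map_sum] at this
      exact this.symm
    rw [this, characterToReal_sum]
    refine Submodule.sum_mem _ fun i _ => ?_
    rw [characterToReal_zsmul]
    exact Submodule.smul_mem _ _ (Submodule.subset_span ⟨i, rfl⟩)
  have hspan : ⊤ ≤ Submodule.span ℝ
      (Set.range fun i => characterToReal (b i : Module.Dual ℤ N)) := by
    intro w _
    obtain ⟨d, hd, hdL⟩ := exists_index_nsmul_mem L
    let c := Module.Free.chooseBasis ℤ N
    have hw : w = ∑ i, w (1 ⊗ₜ c i) • characterToReal (c.coord i) := by
      apply dual_ext_of_tmul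
      intro y
      rw [LinearMap.sum_apply]
      conv_lhs => rw [← c.sum_repr y, TensorProduct.tmul_sum, map_sum]
      refine Finset.sum_congr rfl fun i _ => ?_
      rw [LinearMap.smul_apply, characterToReal_apply, TensorProduct.tmul_smul, map_zsmul]
      simp [mul_comm]
    rw [hw]
    refine Submodule.sum_mem _ fun i _ => Submodule.smul_mem _ _ ?_
    have h1 := hL _ (hdL (c.coord i))
    rw [← natCast_zsmul, characterToReal_zsmul] at h1
    have h2 := Submodule.smul_mem _ ((d : ℝ)⁻¹) h1
    rwa [smul_smul, Int.cast_natCast, inv_mul_cancel₀ (by exact_mod_cast hd), one_smul] at h2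
  refine ⟨basisOfTopLeSpanOfCardEqFinrank _ hspan (by rw [Fintype.card_fin, hn]), fun i => ?_⟩
  simp

/-- Rounding: a real functional that is positive on finitely many lattice vectors and vanishes on
another one can be replaced by a lattice functional. -/
theorem exists_mem_pairing_pos [Module.Free ℤ N] [Module.Finite ℤ N] [L.FiniteIndex] {ι : Type*}
    [Finite ι] (x : ι → N) (y : N) (f : Module.Dual ℝ (ℝ ⊗[ℤ] N)) (hy : f (1 ⊗ₜ y) = 0)
    (hx : ∀ i, 0 < f (1 ⊗ₜ x i)) : ∃ u ∈ L, u y = 0 ∧ ∀ i, 0 < u (x i) := by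
  obtain ⟨n, ⟨b⟩⟩ : ∃ n, Nonempty (Module.Basis (Fin n) ℤ L) :=
    ⟨_, ⟨Module.finBasis ℤ L.toIntSubmodule⟩⟩
  obtain ⟨B, hB⟩ := exists_basis_characterToReal b
  obtain ⟨l, hl, hdvd⟩ := exists_pairing_dvd L y
  -- Correct the basis by multiples of l so that it vanishes at y. The division is exact, and as f
  -- vanishes at y the corrections cancel in the expansion of f.
  let b' : Fin n → Module.Dual ℤ N := fun i =>
    (b i : Module.Dual ℤ N) - (((b i : Module.Dual ℤ N) y) / l y) • l
  have hb'L : ∀ i, b' i ∈ L := fun i => L.sub_mem (b i).2 (L.zsmul_mem hl _)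
  have hb'y : ∀ i, b' i y = 0 := fun i => by
    simp [b', Int.ediv_mul_cancel (hdvd _ (b i).2)]
  have hf : ∀ z, f (1 ⊗ₜ z) = ∑ i, B.repr f i * ((b i : Module.Dual ℤ N) z : ℝ) := by
    intro z
    conv_lhs => rw [← B.sum_repr f]
    simp [hB, characterToReal_apply]
  have hf' : ∀ z, f (1 ⊗ₜ z) = ∑ i, B.repr f i * (b' i z : ℝ) := by
    intro z
    have h0 : ∑ i, B.repr f i * ((((b i : Module.Dual ℤ N) y) / l y : ℤ) : ℝ) = 0 := by
      by_cases hly : l y = 0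
      · simp [hly]
      · have hly' : (l y : ℝ) ≠ 0 := by exact_mod_cast hly
        have := hf y
        rw [hy] at this
        rw [← mul_left_inj' hly', zero_mul, Finset.sum_mul, this]
        refine Finset.sum_congr rfl fun i _ => ?_
        rw [mul_assoc]
        congr 1
        exact_mod_cast Int.ediv_mul_cancel (hdvd _ (b i).2)
    have h1 : ∀ i, B.repr f i * (b' i z : ℝ) = B.repr f i * ((b i : Module.Dual ℤ N) z : ℝ) -
        B.repr f i * ((((b i : Module.Dual ℤ N) y) / l y : ℤ) : ℝ) * (l z : ℝ) := by
      intro i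
      simp only [b', LinearMap.sub_apply, LinearMap.smul_apply, smul_eq_mul, Int.cast_sub,
        Int.cast_mul]
      ring
    rw [Finset.sum_congr rfl fun i _ => h1 i, Finset.sum_sub_distrib, ← Finset.sum_mul, h0,
      zero_mul, sub_zero, hf]
  -- Rounding the coefficients of T f down changes its value at x i by at most this sum, which does
  -- not depend on T.
  obtain ⟨T, hT⟩ : ∃ T : ℝ, ∀ i, ∑ j, |(b' j (x i) : ℝ)| < T * f (1 ⊗ₜ x i) := by
    have : ∀ᶠ T : ℝ in Filter.atTop, ∀ i, ∑ j, |(b' j (x i) : ℝ)| < T * f (1 ⊗ₜ x i) := by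
      rw [Filter.eventually_all]
      intro i
      exact (Filter.Tendsto.atTop_mul_const (hx i) Filter.tendsto_id).eventually_gt_atTop _
    exact this.exists
  refine ⟨∑ j, ⌊T * B.repr f j⌋ • b' j, L.sum_mem fun j _ => L.zsmul_mem (hb'L j) _, ?_, ?_⟩
  · simp [LinearMap.sum_apply, hb'y]
  · intro i
    have key : T * f (1 ⊗ₜ x i) - ∑ j, |(b' j (x i) : ℝ)| ≤
        ∑ j, (⌊T * B.repr f j⌋ : ℝ) * (b' j (x i) : ℝ) := by
      rw [hf', Finset.mul_sum, ← Finset.sum_sub_distrib]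
      refine Finset.sum_le_sum fun j _ => ?_
      have h1 := Int.floor_le (T * B.repr f j)
      have h2 := Int.lt_floor_add_one (T * B.repr f j)
      have h3 : |(T * B.repr f j - ⌊T * B.repr f j⌋) * (b' j (x i) : ℝ)| ≤ |(b' j (x i) : ℝ)| := by
        rw [abs_mul]
        refine mul_le_of_le_one_left (abs_nonneg _) ?_
        rw [abs_le]
        constructor <;> linarith
      have := (abs_le.1 h3).2
      linarith
    have h4 : (0 : ℝ) < ∑ j, (⌊T * B.repr f j⌋ : ℝ) * (b' j (x i) : ℝ) := by
      linarith [hT i]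
    rw [LinearMap.sum_apply]
    simp only [LinearMap.smul_apply, smul_eq_mul]
    exact_mod_cast h4

end Toric

section Toric

/-! ### The semigroup of a cone -/

variable {N : Type*} [AddCommGroup N] {σ : PointedCone ℝ (ℝ ⊗[ℤ] N)} {r : ℕ} {v : Fin r → N}
variable {L : AddSubgroup (Module.Dual ℤ N)}

theorem IsPrimitiveGenerators.sum_mem (hv : IsPrimitiveGenerators σ v) {l : Fin r → ℝ}
    (hl : ∀ i, 0 ≤ l i) (A : Finset (Fin r)) : ∑ i ∈ A, l i • ((1 : ℝ) ⊗ₜ[ℤ] v i) ∈ σ := by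
  refine Submodule.sum_mem _ fun i _ => ?_
  have h : (1 : ℝ) ⊗ₜ[ℤ] v i ∈ σ := by
    rw [← hv.generates]
    exact PointedCone.subset_hull ⟨i, rfl⟩
  exact σ.smul_mem (hl i) h

theorem one_tmul_ne_zero [Module.Free ℤ N] {y : N} (hy : y ≠ 0) : (1 : ℝ) ⊗ₜ[ℤ] y ≠ 0 := by
  intro h
  obtain ⟨u, hu⟩ := exists_dual_apply_ne_zero hy
  have := characterToReal_apply u y
  rw [h, map_zero] at this
  exact hu (by exact_mod_cast this.symm)

/-- A nonzero term and its negative, the sum of the other terms, would both lie in the salient cone.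
-/
theorem IsPrimitiveGenerators.eq_zero_of_sum_eq_zero [Module.Free ℤ N]
    (hσ : σ.toConvexCone.Salient) (hv : IsPrimitiveGenerators σ v) {l : Fin r → ℝ}
    (hl : ∀ i, 0 ≤ l i) (h : ∑ i, l i • ((1 : ℝ) ⊗ₜ[ℤ] v i) = 0) (i : Fin r) : l i = 0 := by
  by_contra hne
  refine hσ (l i • ((1 : ℝ) ⊗ₜ[ℤ] v i)) ?_
    (smul_ne_zero hne (one_tmul_ne_zero (hv.primitive i).1)) ?_
  · simpa using hv.sum_mem hl {i}
  · have : -(l i • ((1 : ℝ) ⊗ₜ[ℤ] v i)) =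
        ∑ j ∈ Finset.univ.erase i, l j • ((1 : ℝ) ⊗ₜ[ℤ] v j) := by
      rw [← Finset.add_sum_erase _ _ (Finset.mem_univ i)] at h
      exact neg_eq_of_add_eq_zero_right h
    rw [this]
    exact hv.sum_mem hl _

theorem mem_coneSemigroup (hv : IsPrimitiveGenerators σ v) {u : Module.Dual ℤ N} :
    u ∈ coneSemigroup σ L ↔ u ∈ L ∧ ∀ i, 0 ≤ u (v i) := by
  refine and_congr_right fun _ => ?_
  rw [dualCone, ← hv.generates, PointedCone.dual_hull, PointedCone.mem_dual]
  simp only [Set.forall_mem_range, Module.Dual.eval_apply, characterToReal_apply,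
    Int.cast_nonneg_iff]

theorem IsPrimitiveGenerators.dual_ext (hσ : Submodule.span ℝ (σ : Set (ℝ ⊗[ℤ] N)) = ⊤)
    (hv : IsPrimitiveGenerators σ v) {f g : Module.Dual ℝ (ℝ ⊗[ℤ] N)}
    (h : ∀ i, f (1 ⊗ₜ v i) = g (1 ⊗ₜ v i)) : f = g := by
  have hle : Submodule.span ℝ (σ : Set (ℝ ⊗[ℤ] N)) ≤ LinearMap.ker (f - g) := by
    rw [Submodule.span_le, ← hv.generates]
    intro x hx
    have : PointedCone.hull ℝ (Set.range fun i => (1 : ℝ) ⊗ₜ[ℤ] v i) ≤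
        (LinearMap.ker (f - g)).restrictScalars {c : ℝ // 0 ≤ c} := by
      refine Submodule.span_le.2 ?_
      rintro _ ⟨i, rfl⟩
      simp [h]
    exact this hx
  rw [hσ] at hle
  refine LinearMap.ext fun x => sub_eq_zero.1 (hle (Submodule.mem_top (x := x)))

theorem IsPrimitiveGenerators.character_ext (hσ : Submodule.span ℝ (σ : Set (ℝ ⊗[ℤ] N)) = ⊤)
    (hv : IsPrimitiveGenerators σ v) {u w : Module.Dual ℤ N} (h : ∀ i, u (v i) = w (v i)) :
    u = w :=
  characterToReal_injective (hv.dual_ext hσ fun i => by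
    rw [characterToReal_apply, characterToReal_apply, h])

variable (L) in
theorem exists_interior_mem [Module.Free ℤ N] [Module.Finite ℤ N] [L.FiniteIndex]
    (hσ : σ.toConvexCone.Salient) (hv : IsPrimitiveGenerators σ v) :
    ∃ u ∈ L, ∀ i, 0 < u (v i) := by
  obtain ⟨f, hf, hpos⟩ := exists_linearMap_pos_of_forall_sum_eq_smul
    (fun i => (1 : ℝ) ⊗ₜ[ℤ] v i) 0 fun l t hl h =>
      hv.eq_zero_of_sum_eq_zero hσ hl (by rw [h, smul_zero])
  obtain ⟨u, hu, -, h⟩ := exists_mem_pairing_pos L v 0 f (by simp) hpos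
  exact ⟨u, hu, h⟩

variable (L) in
-- A lattice point in the relative interior of the facet of σ^∨ dual to the ray of v_i. In the
-- separation hypothesis, t ≤ 0 is handled by saliency, and t > 0 would contradict minimality of the
-- generators.
theorem exists_facet_mem [Module.Free ℤ N] [Module.Finite ℤ N] [L.FiniteIndex]
    (hσ : σ.toConvexCone.Salient) (hv : IsPrimitiveGenerators σ v) (i : Fin r) :
    ∃ u ∈ L, u (v i) = 0 ∧ ∀ j, j ≠ i → 0 < u (v j) := by
  classical
  obtain ⟨f, hf, hpos⟩ := exists_linearMap_pos_of_forall_sum_eq_smul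
    (fun j : {j // j ≠ i} => (1 : ℝ) ⊗ₜ[ℤ] v j) ((1 : ℝ) ⊗ₜ[ℤ] v i) fun l t hl h => by
      rcases le_or_gt t 0 with ht | ht
      · let l' : Fin r → ℝ := fun j => if hj : j = i then -t else l ⟨j, hj⟩
        have hl' : ∀ j, 0 ≤ l' j := fun j => by
          by_cases hj : j = i
          · simp [l', hj, ht]
          · simp [l', hj, hl]
        have hsum : ∑ j, l' j • ((1 : ℝ) ⊗ₜ[ℤ] v j) = 0 := by
          rw [Fintype.sum_eq_add_sum_subtype_ne _ i]
          have : ∑ j : {j // j ≠ i}, l' j • ((1 : ℝ) ⊗ₜ[ℤ] v j) = t • ((1 : ℝ) ⊗ₜ[ℤ] v i) := by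
            rw [← h]
            exact Finset.sum_congr rfl fun j _ => by simp [l', j.2]
          rw [this]
          simp [l']
        intro j
        have := hv.eq_zero_of_sum_eq_zero hσ hl' hsum j
        simpa [l', j.2] using this
      · exfalso
        apply hv.minimal i
        have : (1 : ℝ) ⊗ₜ[ℤ] v i =
            ∑ j : {j // j ≠ i}, (t⁻¹ * l j) • ((1 : ℝ) ⊗ₜ[ℤ] v j) := by
          simp_rw [mul_smul]
          rw [← Finset.smul_sum, h, smul_smul, inv_mul_cancel₀ ht.ne', one_smul]
        rw [this]
        refine sum_mem fun j _ => ?_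
        exact Submodule.smul_mem _
          (⟨t⁻¹ * l j, mul_nonneg (inv_nonneg.2 ht.le) (hl j)⟩ : {c : ℝ // 0 ≤ c})
          (PointedCone.subset_hull ⟨j, j.2, rfl⟩)
  obtain ⟨u, hu, h0, h⟩ := exists_mem_pairing_pos L (fun j : {j // j ≠ i} => v j) (v i) f hf hpos
  exact ⟨u, hu, h0, fun j hj => h ⟨j, hj⟩⟩

theorem exists_nsmul_add_nonneg (x : Fin r → ℤ) (y : Fin r → ℤ) :
    ∃ m : ℕ, ∀ i, 0 < x i → 0 ≤ m * x i + y i := by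
  refine ⟨∑ i, (y i).natAbs, fun i hi => ?_⟩
  have h1 : ((y i).natAbs : ℤ) ≤ (∑ i, (y i).natAbs : ℕ) := by
    exact_mod_cast Finset.single_le_sum (f := fun i => (y i).natAbs) (fun _ _ => Nat.zero_le _)
      (Finset.mem_univ i)
  have h2 : -((y i).natAbs : ℤ) ≤ y i := by omega
  nlinarith

/-- Adding a large multiple of an interior element of σ^∨ moves any element of L into the cone. -/
theorem exists_add_eq_of_mem [Module.Free ℤ N] [Module.Finite ℤ N] [L.FiniteIndex]
    (hσ : σ.toConvexCone.Salient) (hv : IsPrimitiveGenerators σ v) {u : Module.Dual ℤ N}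
    (hu : u ∈ L) : ∃ s ∈ coneSemigroup σ L, ∃ t ∈ coneSemigroup σ L, u + s = t := by
  obtain ⟨w, hw, hpos⟩ := exists_interior_mem L hσ hv
  obtain ⟨m, hm⟩ := exists_nsmul_add_nonneg (fun i => w (v i)) (fun i => u (v i))
  refine ⟨m • w, (mem_coneSemigroup hv).2 ⟨L.nsmul_mem hw m, fun i => ?_⟩, u + m • w,
    (mem_coneSemigroup hv).2 ⟨L.add_mem hu (L.nsmul_mem hw m), fun i => ?_⟩, rfl⟩
  · rw [LinearMap.smul_apply]
    exact nsmul_nonneg (hpos i).le m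
  · rw [LinearMap.add_apply, LinearMap.smul_apply, nsmul_eq_mul, add_comm]
    exact hm i (hpos i)

theorem closure_coneSemigroup [Module.Free ℤ N] [Module.Finite ℤ N] [L.FiniteIndex]
    (hσ : σ.toConvexCone.Salient) (hv : IsPrimitiveGenerators σ v) :
    AddSubgroup.closure (coneSemigroup σ L : Set (Module.Dual ℤ N)) = L := by
  refine le_antisymm ((AddSubgroup.closure_le L).2 fun u hu => hu.1) fun u hu => ?_
  obtain ⟨s, hs, t, ht, h⟩ := exists_add_eq_of_mem hσ hv hu
  rw [eq_sub_of_add_eq h]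
  exact AddSubgroup.sub_mem _ (AddSubgroup.subset_closure ht) (AddSubgroup.subset_closure hs)

/-- Gordan's lemma: the pairings with the v_i embed S in ℕ^r, and the image is closed under those
differences that stay in ℕ^r; such submonoids are finitely generated. -/
theorem fg_coneSemigroup (hσ : Submodule.span ℝ (σ : Set (ℝ ⊗[ℤ] N)) = ⊤)
    (hv : IsPrimitiveGenerators σ v) : AddMonoid.FG (coneSemigroup σ L) := by
  have hnn : ∀ (u : coneSemigroup σ L) i, 0 ≤ (u : Module.Dual ℤ N) (v i) := fun u =>
    ((mem_coneSemigroup hv).1 u.2).2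
  let f : coneSemigroup σ L →+ (Fin r → ℕ) :=
    { toFun := fun u i => ((u : Module.Dual ℤ N) (v i)).toNat
      map_zero' := by
        funext i
        simp
      map_add' := fun u w => by
        funext i
        exact Int.toNat_add (hnn u i) (hnn w i) }
  have hf : ∀ u i, (f u i : ℤ) = (u : Module.Dual ℤ N) (v i) := fun u i =>
    Int.toNat_of_nonneg (hnn u i)
  have hinj : Function.Injective f := by
    intro u w h
    refine Subtype.ext (hv.character_ext hσ fun i => ?_)
    rw [← hf, ← hf, h]
  have hfg : (AddMonoidHom.mrange f).FG := by
    refine AddSubmonoid.fg_of_subtractive ?_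
    rintro _ ⟨u, rfl⟩ y ⟨w, hw⟩
    have hy : ∀ i, ((w : Module.Dual ℤ N) - u) (v i) = y i := fun i => by
      rw [LinearMap.sub_apply, ← hf, ← hf, hw]
      simp
    have hmem : (w : Module.Dual ℤ N) - u ∈ coneSemigroup σ L :=
      (mem_coneSemigroup hv).2 ⟨L.sub_mem w.2.1 u.2.1, fun i => by rw [hy]; positivity⟩
    refine ⟨⟨_, hmem⟩, funext fun i => ?_⟩
    have := hf ⟨_, hmem⟩ i
    rw [hy] at this
    exact_mod_cast this
  refine ⟨AddSubmonoid.FG.map_injective f hinj ?_⟩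
  rwa [← AddMonoidHom.mrange_eq_map]

theorem coneSemigroup_pointed (hσ : Submodule.span ℝ (σ : Set (ℝ ⊗[ℤ] N)) = ⊤)
    (hv : IsPrimitiveGenerators σ v) (s t : coneSemigroup σ L) (h : s + t = 0) : s = 0 := by
  refine Subtype.ext (hv.character_ext hσ fun i => ?_)
  have hs := ((mem_coneSemigroup hv).1 s.2).2 i
  have ht := ((mem_coneSemigroup hv).1 t.2).2 i
  have h0 : (s : Module.Dual ℤ N) (v i) + (t : Module.Dual ℤ N) (v i) = 0 := by
    rw [← LinearMap.add_apply, ← AddSubmonoid.coe_add, h]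
    rfl
  have : ((0 : coneSemigroup σ L) : Module.Dual ℤ N) (v i) = 0 := rfl
  omega

/-! ### Free degrees and the signature polytope -/

open FrobeniusPushforward

/-- Since differences of elements of S fill L, the classes are traces of cosets of qL. -/
theorem degreeSetoid_coneSemigroup_iff [Module.Free ℤ N] [Module.Finite ℤ N] [L.FiniteIndex]
    (hσ : σ.toConvexCone.Salient) (hv : IsPrimitiveGenerators σ v) {q : ℕ}
    {u w : coneSemigroup σ L} :
    degreeSetoid (coneSemigroup σ L) q u w ↔
      ∃ l ∈ L, (u : Module.Dual ℤ N) = w + q • l := by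
  constructor
  · rintro ⟨s, t, h⟩
    refine ⟨t - s, L.sub_mem t.2.1 s.2.1, ?_⟩
    have := congrArg Subtype.val h
    simp only [AddSubmonoid.coe_add, AddSubmonoidClass.coe_nsmul] at this
    rw [smul_sub, ← add_sub_assoc, ← this, add_sub_cancel_right]
  · rintro ⟨l, hl, h⟩
    obtain ⟨s, hs, t, ht, hst⟩ := exists_add_eq_of_mem hσ hv hl
    refine ⟨⟨s, hs⟩, ⟨t, ht⟩, Subtype.ext ?_⟩
    simp only [AddSubmonoid.coe_add, AddSubmonoidClass.coe_nsmul]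
    subst hst
    rw [h, nsmul_add, add_assoc]

theorem finite_quotient_degreeSetoid [Module.Free ℤ N] [Module.Finite ℤ N] [L.FiniteIndex]
    (hσ : σ.toConvexCone.Salient) (hv : IsPrimitiveGenerators σ v) {n : ℕ}
    (b : Module.Basis (Fin n) ℤ L) {q : ℕ} (hq : q ≠ 0) :
    Finite (Quotient (degreeSetoid (coneSemigroup σ L) q)) := by
  have : NeZero q := ⟨hq⟩
  refine Finite.of_injective
    (fun c => fun i : Fin n => ((b.repr ⟨c.out, c.out.2.1⟩ i : ℤ) : ZMod q)) fun c d h => ?_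
  rw [← Quotient.out_eq c, ← Quotient.out_eq d]
  refine Quotient.sound ((degreeSetoid_coneSemigroup_iff hσ hv).2 ?_)
  have hdvd : ∀ i, (q : ℤ) ∣ b.repr ⟨c.out, c.out.2.1⟩ i - b.repr ⟨d.out, d.out.2.1⟩ i := fun i =>
    (ZMod.intCast_eq_intCast_iff_dvd_sub _ _ _).1 (congrFun h i).symm
  choose z hz using hdvd
  refine ⟨(∑ i, z i • b i : L), (∑ i, z i • b i : L).2, ?_⟩
  have key : (⟨c.out, c.out.2.1⟩ : L) = ⟨d.out, d.out.2.1⟩ + q • ∑ i, z i • b i := by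
    apply b.repr.injective
    ext i
    have := hz i
    rw [map_add, map_nsmul, Finsupp.add_apply, Finsupp.smul_apply, b.repr_sum_self, nsmul_eq_mul]
    linarith
  exact congrArg Subtype.val key

/-- The link between algebra and polytope: w fails to generate its class exactly when some w + q•g
stays in the cone with g ∈ L outside it, and the cheapest way to leave through the i-th facet costs
q c_i. -/
theorem mem_freeDegrees_coneSemigroup_iff [Module.Free ℤ N] [Module.Finite ℤ N] [L.FiniteIndex]
    (hσ : σ.toConvexCone.Salient) (hv : IsPrimitiveGenerators σ v) {q : ℕ} (hq : q ≠ 0)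
    {w : coneSemigroup σ L} :
    w ∈ freeDegrees (coneSemigroup σ L) q ↔
      ∀ i, (w : Module.Dual ℤ N) (v i) < q * minPairing L (v i) := by
  have hq0 : (0 : ℤ) < q := by exact_mod_cast Nat.pos_of_ne_zero hq
  constructor
  · intro hw i
    by_contra! hi
    obtain ⟨hc, -, l, hl, hli⟩ := minPairing_spec L (hv.primitive i).1
    obtain ⟨f, hf, hfi, hfj⟩ := exists_facet_mem L hσ hv i
    obtain ⟨m, hm⟩ := exists_nsmul_add_nonneg (fun j => f (v j)) (fun j => -l (v j))
    -- g pairs to −c_i with v_i, and f makes it nonnegative on the other generators. So w + q•g is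
    -- in S when w·v_i ≥ q c_i, although g is not.
    let g : Module.Dual ℤ N := m • f - l
    have hg : ∀ j, g (v j) = m * f (v j) + -l (v j) := fun j => by
      simp [g, sub_eq_add_neg]
    have hgL : g ∈ L := L.sub_mem (L.nsmul_mem hf m) hl
    have hu : (w : Module.Dual ℤ N) + q • g ∈ coneSemigroup σ L := by
      refine (mem_coneSemigroup hv).2 ⟨L.add_mem w.2.1 (L.nsmul_mem hgL q), fun j => ?_⟩
      rw [LinearMap.add_apply, LinearMap.smul_apply, nsmul_eq_mul, hg]
      by_cases hj : j = i
      · subst hj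
        rw [hfi, hli]
        linarith
      · have h1 := hm j (hfj j hj)
        have h2 := ((mem_coneSemigroup hv).1 w.2).2 j
        exact add_nonneg h2 (mul_nonneg hq0.le h1)
    obtain ⟨s, hs⟩ := hw ⟨_, hu⟩ ((degreeSetoid_coneSemigroup_iff hσ hv).2 ⟨g, hgL, rfl⟩)
    have h3 := congrArg (fun u : coneSemigroup σ L => (u : Module.Dual ℤ N) (v i)) hs
    simp only [AddSubmonoid.coe_add, AddSubmonoidClass.coe_nsmul, LinearMap.add_apply,
      LinearMap.smul_apply, nsmul_eq_mul, hg, hfi, hli] at h3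
    have h4 := ((mem_coneSemigroup hv).1 s.2).2 i
    have h5 : (0 : ℤ) < minPairing L (v i) := by exact_mod_cast hc
    have h6 := mul_pos hq0 h5
    have h7 := mul_nonneg hq0.le h4
    linarith
  · intro h u hu
    obtain ⟨l, hl, hul⟩ := (degreeSetoid_coneSemigroup_iff hσ hv).1 hu
    refine ⟨⟨l, (mem_coneSemigroup hv).2 ⟨hl, fun i => ?_⟩⟩, Subtype.ext hul⟩
    obtain ⟨hc, hdvd, -⟩ := minPairing_spec L (hv.primitive i).1
    obtain ⟨z, hz⟩ := hdvd l hl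
    have h1 := ((mem_coneSemigroup hv).1 u.2).2 i
    rw [hul, LinearMap.add_apply, LinearMap.smul_apply, nsmul_eq_mul, hz] at h1
    have h2 := h i
    have h5 : (0 : ℤ) < minPairing L (v i) := by exact_mod_cast hc
    -- From w·v_i < q c_i follows l·v_i > −c_i; being a multiple z c_i, it is nonnegative.
    have h6 : 0 < (q * minPairing L (v i) : ℤ) * (1 + z) := by nlinarith
    have h7 : 0 < 1 + z := (mul_pos_iff_of_pos_left (mul_pos hq0 h5)).1 h6
    rw [hz]
    exact mul_nonneg h5.le (by omega)

theorem image_freeDegrees [Module.Free ℤ N] [Module.Finite ℤ N] [L.FiniteIndex]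
    (hσ : σ.toConvexCone.Salient) (hv : IsPrimitiveGenerators σ v) {q : ℕ} (hq : q ≠ 0) :
    (fun w : coneSemigroup σ L => (q : ℝ)⁻¹ • characterToReal (w : Module.Dual ℤ N)) ''
      freeDegrees (coneSemigroup σ L) q = signaturePolytope L v ∩ fractionalLattice L q := by
  have hq0 : (0 : ℝ) < q := by exact_mod_cast Nat.pos_of_ne_zero hq
  have key : ∀ (u : Module.Dual ℤ N) i,
      ((q : ℝ)⁻¹ • characterToReal u) (1 ⊗ₜ v i) = (u (v i) : ℝ) / q := fun u i => by
    rw [LinearMap.smul_apply, characterToReal_apply, smul_eq_mul, inv_mul_eq_div]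
  have hlt : ∀ (u : Module.Dual ℤ N) i, (u (v i) : ℝ) / q < minPairing L (v i) ↔
      u (v i) < q * minPairing L (v i) := fun u i => by
    rw [div_lt_iff₀' hq0]
    exact_mod_cast Iff.rfl
  ext x
  constructor
  · rintro ⟨w, hw, rfl⟩
    refine ⟨fun i => ?_, w, w.2.1, rfl⟩
    rw [key, hlt]
    refine ⟨div_nonneg ?_ hq0.le, (mem_freeDegrees_coneSemigroup_iff hσ hv hq).1 hw i⟩
    exact_mod_cast ((mem_coneSemigroup hv).1 w.2).2 i
  · rintro ⟨hx, u, hu, rfl⟩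
    have hu' : u ∈ coneSemigroup σ L := by
      refine (mem_coneSemigroup hv).2 ⟨hu, fun i => ?_⟩
      have := (hx i).1
      rw [key, le_div_iff₀ hq0, zero_mul] at this
      exact_mod_cast this
    refine ⟨⟨u, hu'⟩, (mem_freeDegrees_coneSemigroup_iff hσ hv hq).2 fun i => ?_, rfl⟩
    rw [← hlt, ← key]
    exact (hx i).2

theorem injective_inv_smul_characterToReal {q : ℕ} (hq : q ≠ 0) :
    Function.Injective fun w : coneSemigroup σ L =>
      (q : ℝ)⁻¹ • characterToReal (w : Module.Dual ℤ N) := by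
  intro u w h
  have hq' : (q : ℝ)⁻¹ ≠ 0 := inv_ne_zero (by exact_mod_cast hq)
  exact Subtype.ext (characterToReal_injective (smul_right_injective _ hq' h))

end Toric

section Toric

open FrobeniusPushforward

variable {N : Type*} [AddCommGroup N] {σ : PointedCone ℝ (ℝ ⊗[ℤ] N)} {r : ℕ} {v : Fin r → N}
variable {L : AddSubgroup (Module.Dual ℤ N)}

/-! ### Volume of the signature polytope -/

/-- The signature polytope in the coordinates given by a basis of the lattice. -/
def polytopeCoordinates {n : ℕ} (b : Module.Basis (Fin n) ℤ L) (v : Fin r → N) :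
    Set (Fin n → ℝ) :=
  {x | ∑ i, x i • characterToReal (b i : Module.Dual ℤ N) ∈ signaturePolytope L v}

/-- As the linear preimage of a half-open box, the polytope inherits measurability and convexity. -/
theorem polytopeCoordinates_eq_preimage {n : ℕ} (b : Module.Basis (Fin n) ℤ L) (v : Fin r → N) :
    ∃ g : (Fin n → ℝ) →ₗ[ℝ] (Fin r → ℝ),
      (∀ x j, g x j =
        (∑ i, x i • characterToReal (b i : Module.Dual ℤ N) : Module.Dual ℝ _) (1 ⊗ₜ v j)) ∧
      polytopeCoordinates b v =
        g ⁻¹' (Set.univ.pi fun j => Set.Ico (0 : ℝ) (minPairing L (v j))) := by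
  refine ⟨LinearMap.pi fun j => LinearMap.applyₗ ((1 : ℝ) ⊗ₜ[ℤ] v j) ∘ₗ
    Fintype.linearCombination ℝ fun i => characterToReal (b i : Module.Dual ℤ N),
    fun x j => rfl, ?_⟩
  ext x
  simp only [Set.mem_preimage, Set.mem_univ_pi, Set.mem_Ico]
  rfl

theorem measurableSet_polytopeCoordinates {n : ℕ} (b : Module.Basis (Fin n) ℤ L)
    (v : Fin r → N) : MeasurableSet (polytopeCoordinates b v) := by
  obtain ⟨g, -, h⟩ := polytopeCoordinates_eq_preimage b v
  rw [h]
  exact g.continuous_of_finiteDimensional.measurable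
    (MeasurableSet.univ_pi fun _ => measurableSet_Ico)

theorem convex_polytopeCoordinates {n : ℕ} (b : Module.Basis (Fin n) ℤ L) (v : Fin r → N) :
    Convex ℝ (polytopeCoordinates b v) := by
  obtain ⟨g, -, h⟩ := polytopeCoordinates_eq_preimage b v
  rw [h]
  exact (convex_pi fun _ _ => convex_Ico _ _).linear_preimage g

/-- The v_i span N_ℝ, so the pairing map is injective, hence antilipschitz in finite dimension, and
pulls the box back to a bounded set. -/
theorem isBounded_polytopeCoordinates [Module.Free ℤ N] [Module.Finite ℤ N] [L.FiniteIndex]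
    (hσ : Submodule.span ℝ (σ : Set (ℝ ⊗[ℤ] N)) = ⊤) (hv : IsPrimitiveGenerators σ v) {n : ℕ}
    (b : Module.Basis (Fin n) ℤ L) : Bornology.IsBounded (polytopeCoordinates b v) := by
  obtain ⟨g, hg, h⟩ := polytopeCoordinates_eq_preimage b v
  obtain ⟨B, hB⟩ := exists_basis_characterToReal b
  have hker : LinearMap.ker g = ⊥ := by
    rw [LinearMap.ker_eq_bot]
    intro x y hxy
    apply B.equivFun.symm.injective
    refine hv.dual_ext hσ fun j => ?_
    rw [B.equivFun_symm_apply, B.equivFun_symm_apply]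
    simp only [hB]
    rw [← hg, ← hg, hxy]
  obtain ⟨K, -, hK⟩ := g.exists_antilipschitzWith hker
  rw [h]
  refine hK.isBounded_preimage (Bornology.IsBounded.subset
    (Metric.isBounded_Icc (0 : Fin r → ℝ) fun j => (minPairing L (v j) : ℝ)) fun y hy => ?_)
  rw [Set.mem_univ_pi] at hy
  exact ⟨fun j => (hy j).1, fun j => (hy j).2.le⟩

theorem latticeVolume_ne_top [Module.Free ℤ N] [Module.Finite ℤ N] [L.FiniteIndex]
    (hσ : Submodule.span ℝ (σ : Set (ℝ ⊗[ℤ] N)) = ⊤) (hv : IsPrimitiveGenerators σ v) {n : ℕ}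
    (b : Module.Basis (Fin n) ℤ L) : latticeVolume b (signaturePolytope L v) ≠ ⊤ :=
  (isBounded_polytopeCoordinates hσ hv b).measure_lt_top.ne

open scoped Pointwise in
theorem ncard_inter_fractionalLattice [Module.Free ℤ N] [Module.Finite ℤ N] [L.FiniteIndex]
    {n : ℕ} (b : Module.Basis (Fin n) ℤ L) (v : Fin r → N) (q : ℕ) :
    (signaturePolytope L v ∩ fractionalLattice L q).ncard =
      Nat.card ↑(polytopeCoordinates b v ∩ (q : ℝ)⁻¹ •
        (Submodule.span ℤ (Set.range (Pi.basisFun ℝ (Fin n))) : Set (Fin n → ℝ))) := by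
  obtain ⟨B, hB⟩ := exists_basis_characterToReal b
  have hΦ : ∀ x : Fin n → ℝ, B.equivFun.symm x =
      ∑ i, x i • characterToReal (b i : Module.Dual ℤ N) := fun x => by
    rw [B.equivFun_symm_apply]
    simp only [hB]
  have himage : signaturePolytope L v ∩ fractionalLattice L q =
      B.equivFun.symm '' (polytopeCoordinates b v ∩ (q : ℝ)⁻¹ •
        (Submodule.span ℤ (Set.range (Pi.basisFun ℝ (Fin n))) : Set (Fin n → ℝ))) := by
    apply Set.Subset.antisymm
    · rintro _ ⟨hx, u, hu, rfl⟩
      have hsum : characterToReal u =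
          B.equivFun.symm fun i => (b.repr ⟨u, hu⟩ i : ℝ) := by
        have := congrArg L.subtype (b.sum_repr ⟨u, hu⟩)
        rw [map_sum] at this
        rw [hΦ]
        conv_lhs => rw [← show ∑ i, b.repr ⟨u, hu⟩ i • (b i : Module.Dual ℤ N) = u from this,
          characterToReal_sum]
        simp only [characterToReal_zsmul]
      refine ⟨(q : ℝ)⁻¹ • fun i => (b.repr ⟨u, hu⟩ i : ℝ), ⟨?_, Set.smul_mem_smul_set ?_⟩, ?_⟩
      · rw [polytopeCoordinates, Set.mem_ofPred_eq, ← hΦ, map_smul, ← hsum]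
        exact hx
      · rw [SetLike.mem_coe, (Pi.basisFun ℝ (Fin n)).mem_span_iff_repr_mem ℤ]
        exact fun i => ⟨b.repr ⟨u, hu⟩ i, by simp⟩
      · rw [map_smul, ← hsum]
    · rintro _ ⟨_, ⟨hx, y, hy, rfl⟩, rfl⟩
      refine ⟨by rw [hΦ]; exact hx, ?_⟩
      rw [SetLike.mem_coe, (Pi.basisFun ℝ (Fin n)).mem_span_iff_repr_mem ℤ] at hy
      choose z hz using hy
      refine ⟨(∑ i, z i • b i : L), (∑ i, z i • b i : L).2, ?_⟩
      have : ((∑ i, z i • b i : L) : Module.Dual ℤ N) = ∑ i, z i • (b i : Module.Dual ℤ N) := by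
        rw [AddSubgroup.val_finsetSum]
        rfl
      change B.equivFun.symm ((q : ℝ)⁻¹ • y) = _
      rw [map_smul, hΦ, this, characterToReal_sum]
      simp only [characterToReal_zsmul]
      congr 1
      refine Finset.sum_congr rfl fun i _ => ?_
      have := hz i
      simp only [Pi.basisFun_repr, algebraMap_int_eq, eq_intCast] at this
      rw [this]
  rw [himage, Set.ncard_image_of_injective _ B.equivFun.symm.injective, Nat.card_coe_set_eq]

/-- In the coordinates of b this counts points of (1/q)ℤ^n in a bounded convex set, whose frontier
has measure zero. -/
theorem tendsto_ncard_inter_fractionalLattice [Module.Free ℤ N] [Module.Finite ℤ N]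
    [L.FiniteIndex] (hσ : Submodule.span ℝ (σ : Set (ℝ ⊗[ℤ] N)) = ⊤)
    (hv : IsPrimitiveGenerators σ v) {n : ℕ} (b : Module.Basis (Fin n) ℤ L) :
    Filter.Tendsto
      (fun q : ℕ => ((signaturePolytope L v ∩ fractionalLattice L q).ncard : ℝ) / (q : ℝ) ^ n)
      Filter.atTop (nhds (latticeVolume b (signaturePolytope L v)).toReal) := by
  have h := tendsto_card_div_pow_atTop_volume (polytopeCoordinates b v)
    (isBounded_polytopeCoordinates hσ hv b) (measurableSet_polytopeCoordinates b v)
    ((convex_polytopeCoordinates b v).addHaar_frontier _)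
  rw [Fintype.card_fin] at h
  simp only [← ncard_inter_fractionalLattice] at h
  exact h

/-! ### The F-signature of an affine toric ring -/

variable {k : Type*} [Field k]

theorem noZeroDivisors_addMonoidAlgebra_of_injective {S : Type*} [AddCommMonoid S]
    [Module.Free ℤ N] [Module.Finite ℤ N] (f : S →+ Module.Dual ℤ N)
    (hf : Function.Injective f) : NoZeroDivisors (AddMonoidAlgebra k S) := by
  have : AddMonoid.FG (Module.Dual ℤ N) :=
    AddGroup.fg_iff_addMonoid_fg.1 (Module.Finite.iff_addGroup_fg.1 inferInstance)
  have : IsAddTorsionFree (Module.Dual ℤ N) := by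
    refine ⟨fun m hm u w h => LinearMap.ext fun y => ?_⟩
    have := LinearMap.congr_fun h y
    simpa [hm] using this
  exact (AddMonoidAlgebra.mapDomain_injective (R := k) hf).noZeroDivisors
    (AddMonoidAlgebra.mapDomainRingHom k f) (map_zero _) (map_mul _)

theorem ringKrullDim_coneSemigroup [Module.Free ℤ N] [Module.Finite ℤ N] [L.FiniteIndex]
    (hσ_convex : σ.toConvexCone.Salient) (hσ_full : Submodule.span ℝ (σ : Set (ℝ ⊗[ℤ] N)) = ⊤)
    (hv : IsPrimitiveGenerators σ v) {n : ℕ} (b : Module.Basis (Fin n) ℤ L) :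
    ringKrullDim (AddMonoidAlgebra k (coneSemigroup σ L)) = n := by
  have := fg_coneSemigroup (L := L) hσ_full hv
  have : NoZeroDivisors (AddMonoidAlgebra k (coneSemigroup σ L)) :=
    noZeroDivisors_addMonoidAlgebra_of_injective (coneSemigroup σ L).subtype
      Subtype.val_injective
  have : NoZeroDivisors (AddMonoidAlgebra k L) :=
    noZeroDivisors_addMonoidAlgebra_of_injective L.subtype Subtype.val_injective
  let f : coneSemigroup σ L →+ L := (coneSemigroup σ L).subtype.codRestrict L fun u => u.2.1
  refine ringKrullDim_addMonoidAlgebra b f (fun u w h => Subtype.ext (congrArg (L.subtype) h))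
    fun g => ?_
  obtain ⟨s, hs, t, ht, h⟩ := exists_add_eq_of_mem hσ_convex hv g.2
  exact ⟨⟨s, hs⟩, ⟨t, ht⟩, Subtype.ext h⟩

end Toric

theorem mainTheorem5
    {N : Type*} [AddCommGroup N] [Module.Free ℤ N] [Module.Finite ℤ N]
    {k : Type*} [Field k] [PerfectField k] (p : ℕ) [Fact p.Prime] [CharP k p]
    (σ : PointedCone ℝ (ℝ ⊗[ℤ] N)) (hσ_convex : σ.toConvexCone.Salient)
    (hσ_full : Submodule.span ℝ (σ : Set (ℝ ⊗[ℤ] N)) = ⊤)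
    {r : ℕ} (v : Fin r → N) (hv : IsPrimitiveGenerators σ v)
    (L : AddSubgroup (Module.Dual ℤ N)) (hL : L.FiniteIndex)
    {n : ℕ} (b : Module.Basis (Fin n) ℤ L) :
    AddSubgroup.closure (coneSemigroup σ L : Set (Module.Dual ℤ N)) = L ∧
    latticeVolume b (signaturePolytope L v) ≠ ⊤ ∧
    IsFSignature (monomialGrading k (coneSemigroup σ L)) p
      (latticeVolume b (signaturePolytope L v)).toReal ∧
    ∀ e : ℕ,
      (signaturePolytope L v ∩ fractionalLattice L (p ^ e)).Finite ∧
      IsFreeRank (R := AddMonoidAlgebra k (coneSemigroup σ L))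
        (FrobeniusPushforward.grading (monomialGrading k (coneSemigroup σ L)) p e)
        (signaturePolytope L v ∩ fractionalLattice L (p ^ e)).ncard ∧
      IsGreatest
        {a : ℕ | HasFreeSummandOfRank (AddMonoidAlgebra k (coneSemigroup σ L))
          (FrobeniusPushforward (AddMonoidAlgebra k (coneSemigroup σ L)) p e) a}
        (signaturePolytope L v ∩ fractionalLattice L (p ^ e)).ncard := by

  have hS := coneSemigroup_pointed (L := L) hσ_full hv
  have : NoZeroDivisors (AddMonoidAlgebra k (coneSemigroup σ L)) :=
    noZeroDivisors_addMonoidAlgebra_of_injective (coneSemigroup σ L).subtype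
      Subtype.val_injective
  have hq : ∀ e, p ^ e ≠ 0 := fun e => pow_ne_zero e (Fact.out : p.Prime).ne_zero
  have hquot : ∀ e, Finite (Quotient (FrobeniusPushforward.degreeSetoid (coneSemigroup σ L)
      (p ^ e))) := fun e => finite_quotient_degreeSetoid hσ_convex hv b (hq e)
  have hcard : ∀ e, (signaturePolytope L v ∩ fractionalLattice L (p ^ e)).ncard =
      (FrobeniusPushforward.freeDegrees (coneSemigroup σ L) (p ^ e)).ncard := fun e => by
    rw [← image_freeDegrees hσ_convex hv (hq e),
      Set.ncard_image_of_injective _ (injective_inv_smul_characterToReal (hq e))]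
  have hrank : ∀ e, IsFreeRank (R := AddMonoidAlgebra k (coneSemigroup σ L))
      (FrobeniusPushforward.grading (monomialGrading k (coneSemigroup σ L)) p e)
      (signaturePolytope L v ∩ fractionalLattice L (p ^ e)).ncard := fun e => by
    rw [hcard]
    exact FrobeniusPushforward.isFreeRank_freeDegrees hS
  refine ⟨closure_coneSemigroup hσ_convex hv, latticeVolume_ne_top hσ_full hv b,
    ⟨n, _, ringKrullDim_coneSemigroup hσ_convex hσ_full hv b, hrank, ?_⟩,
    fun e => ⟨?_, hrank e, ?_⟩⟩
  -- The limit over all q is restricted to the subsequence q = p^e.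
  · have h := (tendsto_ncard_inter_fractionalLattice hσ_full hv b).comp
      (tendsto_pow_atTop_atTop_of_one_lt (Fact.out : p.Prime).one_lt)
    refine h.congr fun e => ?_
    simp [pow_mul]
  · rw [← image_freeDegrees hσ_convex hv (hq e)]
    exact (FrobeniusPushforward.finite_freeDegrees hS _).image _
  · rw [hcard]
    exact FrobeniusPushforward.isGreatest_freeDegrees hS
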